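/- **Notation.** Let $t$ be an indeterminate, $\mathbf x=(x_1,x_2,\dots)$, $\mathbf y=(y_1,y_2,\dots)$, and define $q_n(\mathbf x)\in\mathbb Q(t)[\mathbf x]$ by $\sum_{n\ge 0}q_n(\mathbf x)z^n=\exp\bigl(\sum_{n\ge1}(1-t^n)x_nz^n\bigr)$ and $q_n=0$ for $n<0$. For integer sequences $\alpha=(\alpha_1,\dots,\alpha_l)$ and $\beta=(\beta_1,\dots,\beta_m)$ put $q_\alpha(\mathbf x)=\prod_i q_{\alpha_i}(\mathbf x)$ and $q_{[\alpha,\beta]}=q_\alpha(\mathbf x)\,q_\beta(\mathbf y)$. Let $R_{\alpha_i\alpha_j}$ raise $\alpha_i$ by $1$ and lower $\alpha_j$ by $1$, and let $D_{\alpha_i\beta_a}$ lower both $\alpha_i$ and $\beta_a$ by $1$. These operators act on formal symbols through their indices: rational expressions in them are expanded as power series in the operators, the resulting monomials act on the indices, and the symbols are evaluated afterwards (only finitely many terms are nonzero). For integer sequences define $$Q_\alpha(\mathbf x)=\prod_{i<j}\frac{1-R_{\alpha_i\alpha_j}}{1-tR_{\alpha_i\alpha_j}}\,q_\alpha(\mathbf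 x),$$ $$Q_{[\alpha,\beta]}(\mathbf x,\mathbf y)=\prod_{i<j}\frac{1-R_{\alpha_i\alpha_j}}{1-tR_{\alpha_i\alpha_j}}\prod_{a<b}\frac{1-R_{\beta_a\beta_b}}{1-tR_{\beta_a\beta_b}}\prod_{i,a}\frac{(1-D_{\alpha_i\beta_a})(1-t^2D_{\alpha_i\beta_a})}{(1-tD_{\alpha_i\beta_a})^2}\,q_{[\alpha,\beta]}.$$ For Young diagrams (partitions, identified with their sequences of positive parts) these are the Hall–Littlewood functions and the coupled Hall–Littlewood functions. Let $\tilde\partial_{\mathbf x}=(\partial_{x_1},\tfrac12\partial_{x_2},\tfrac13\partial_{x_3},\dots)$, and similarly $\tilde\partial_{\mathbf y}$. For $p\in\mathbb Q(t)[\mathbf x]$, $p(\mathbf x-\tilde\partial_{\mathbf y})$ and $p(\mathbf y-\tilde\partial_{\mathbf x})$ denote the operators on $\mathbb Q(t)[\mathbf x,\mathbf y]$ obtained by substituting for $x_n$ the (mutually commuting) operators $x_n-\tfrac1n\partial_{y_n}$, respectively $y_n-\tfrac1n\partial_{x_n}$. For integer sequences $\kappa,\nu,\theta,\eta$ put $$\Phi(\kappa,\nu,\theta,\eta)=\bigl(Q_\kappa(\mathbf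 x-\tilde\partial_{\mathbf y})\,Q_\nu(\mathbf x-\tilde\partial_{\mathbf y})\,Q_\theta(\mathbf y-\tilde\partial_{\mathbf x})\,Q_\eta(\mathbf y-\tilde\partial_{\mathbf x})\bigr)\cdot 1 .$$ **Proposition.** Let $\kappa,\theta,\nu,\eta$ be Young diagrams. Then there are unique finite expansions $Q_\kappa Q_\nu=\sum_\lambda f^\lambda_{\kappa\nu}Q_\lambda$ and $Q_\theta Q_\eta=\sum_\mu f^\mu_{\theta\eta}Q_\mu$ with coefficients in $\mathbb Q(t)$, where $\lambda,\mu$ run over Young diagrams, and $$Q_{[\kappa,\theta]}\,Q_{[\nu,\eta]}=\prod_{i,j}\frac{(1-tD_{\kappa_i\eta_j})^2}{(1-D_{\kappa_i\eta_j})(1-t^2D_{\kappa_i\eta_j})}\prod_{m,n}\frac{(1-tD_{\theta_m\nu_n})^2}{(1-D_{\theta_m\nu_n})(1-t^2D_{\theta_m\nu_n})}\;\Phi(\kappa,\nu,\theta,\eta),$$ where the operators $D$ act on the indices of the formal symbol $\Phi(\kappa,\nu,\theta,\eta)$, so that only finitely many monomials in them give a nonzero term, and $$\Phi(\kappa,\nu,\theta,\eta)=\sum_{\lambda,\mu}f^\lambda_{\kappa\nu}\,f^\mu_{\theta\eta}\,Q_{[\lambda,\mu]}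 .$$ -/

import Mathlib

open scoped PowerSeries

noncomputable section

namespace CoupledHL

/-- The coefficient field `ℚ(t)`. -/
abbrev K : Type := RatFunc ℚ

/-- The indeterminate `t` of `ℚ(t)`. -/
def t : K := RatFunc.X

/-- The ring `ℚ(t)[x₁, x₂, …]`. -/
abbrev Pol : Type := MvPolynomial ℕ+ K

/-- The ring `ℚ(t)[x₁, x₂, …, y₁, y₂, …]`; `x_n` is the variable `Sum.inl n` and `y_n` is the
variable `Sum.inr n`. -/
abbrev Pol₂ : Type := MvPolynomial (ℕ+ ⊕ ℕ+) K

/-- The series `ξ_t(x, z) = ∑_{n ≥ 1} (1 - tⁿ) x_n zⁿ`, in the variable `z`. -/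
def xi : Pol⟦X⟧ :=
  PowerSeries.mk fun n =>
    if h : 0 < n then MvPolynomial.C (1 - t ^ n) * MvPolynomial.X (⟨n, h⟩ : ℕ+) else 0

/-- `q_n(x)` is the coefficient of `zⁿ` in `exp (ξ_t(x, z))`, and `0` for `n < 0`. -/
def q : ℤ → Pol
  | Int.ofNat n => PowerSeries.coeff n (PowerSeries.subst xi (PowerSeries.exp Pol))
  | Int.negSucc _ => 0

/-- Formal operator calculus on index vectors. For a finite family of commuting shift operators
`S_e : a ↦ a + s e` of an index lattice `A` and power series `φ_e` in one variable over `ℚ(t)`,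
this is `∏_e φ_e(S_e)` applied to the formal symbol `F a`: the product is expanded into monomials
`∏_e S_e ^ (k e)`, these act on the index `a`, and only then is `F` evaluated. In every use below
only finitely many terms do not vanish. -/
def applyOps {ι A V : Type} [Fintype ι] [AddCommGroup A] [AddCommGroup V] [Module K V]
    (φ : ι → K⟦X⟧) (s : ι → A) (F : A → V) (a : A) : V :=
  ∑ᶠ k : ι → ℕ, (∏ e, PowerSeries.coeff (k e) (φ e)) • F (a + ∑ e, k e • s e)

/-- The series `(1 - u) / (1 - t u)`. -/
def raisingSeries : K⟦X⟧ :=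
  (1 - PowerSeries.X) * (1 - PowerSeries.C t * PowerSeries.X)⁻¹

/-- The series `(1 - u) (1 - t² u) / (1 - t u)²`. -/
def couplingSeries : K⟦X⟧ :=
  (1 - PowerSeries.X) * (1 - PowerSeries.C (t ^ 2) * PowerSeries.X) *
    ((1 - PowerSeries.C t * PowerSeries.X) ^ 2)⁻¹

/-- The series `(1 - t u)² / ((1 - u) (1 - t² u))`. -/
def decouplingSeries : K⟦X⟧ :=
  (1 - PowerSeries.C t * PowerSeries.X) ^ 2 *
    ((1 - PowerSeries.X) * (1 - PowerSeries.C (t ^ 2) * PowerSeries.X))⁻¹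

/-- The pairs `i < j` of positions. -/
abbrev Pairs (l : ℕ) : Type := {p : Fin l × Fin l // p.1 < p.2}

/-- The unit vector `e_i`. -/
def unitVec {l : ℕ} (i : Fin l) : Fin l → ℤ := Pi.single i 1

/-- The shift of `R_{ij}`: raise position `i` by one and lower position `j` by one. -/
def raise {l : ℕ} (p : Pairs l) : Fin l → ℤ := unitVec p.1.1 - unitVec p.1.2

/-- The Hall-Littlewood function `∏_{i<j} (1 - R_{ij}) / (1 - t R_{ij}) q_α(x)`, for any integer
sequence `α`. -/
def hlSeq {l : ℕ} (α : Fin l → ℤ) : Pol :=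
  applyOps (fun _ : Pairs l => raisingSeries) raise (fun β : Fin l → ℤ => ∏ i, q (β i)) α

/-- The formal symbol `q_{[α,β]}(x, y) = ∏ q_{α_i}(x) ∏ q_{β_a}(y)`. -/
def qPair {l m : ℕ} (a : (Fin l → ℤ) × (Fin m → ℤ)) : Pol₂ :=
  (∏ i, MvPolynomial.rename Sum.inl (q (a.1 i))) * ∏ j, MvPolynomial.rename Sum.inr (q (a.2 j))

/-- The coupled Hall-Littlewood function of a pair of integer sequences: the operators
`(1 - R) / (1 - t R)` for the pairs of positions in the first sequence and in the second one, and
`(1 - D) (1 - t² D) / (1 - t D)²`, where `D` lowers one position in each of the two sequences,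
applied to `q_{[α,β]}`. -/
def coupledSeq {l m : ℕ} (α : Fin l → ℤ) (β : Fin m → ℤ) : Pol₂ :=
  applyOps
    (Sum.elim (fun _ : Pairs l => raisingSeries)
      (Sum.elim (fun _ : Pairs m => raisingSeries) (fun _ : Fin l × Fin m => couplingSeries)))
    (Sum.elim (fun p => (raise p, 0))
      (Sum.elim (fun p => (0, raise p)) (fun d => (-unitVec d.1, -unitVec d.2))))
    qPair (α, β)

/-- The parts `(λ₁, …, λ_l)` of a Young diagram with `l` rows. -/
def parts (lam : YoungDiagram) : Fin (lam.colLen 0) → ℤ := fun i => (lam.rowLen i : ℤ)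

/-- The Hall-Littlewood function `Q_λ(x)`. -/
def Q (lam : YoungDiagram) : Pol := hlSeq (parts lam)

/-- The coupled Hall-Littlewood function `Q_{[λ,μ]}(x, y)`. -/
def coupledQ (lam mu : YoungDiagram) : Pol₂ := coupledSeq (parts lam) (parts mu)

/-- The coefficients `λ ↦ f^λ_{κν}` of the expansion `Q_κ Q_ν = ∑_λ f^λ_{κν} Q_λ`. -/
def structureConst (kap nu : YoungDiagram) : YoungDiagram →₀ K :=
  Classical.epsilon fun f => Finsupp.linearCombination K Q f = Q kap * Q nu

/-- The operator `X_{a(n)} - (1/n) ∂/∂X_{b(n)}` on `ℚ(t)[x, y]`. -/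
def shiftOp (a b : ℕ+ → ℕ+ ⊕ ℕ+) (n : ℕ+) : Module.End K Pol₂ :=
  LinearMap.mulLeft K (MvPolynomial.X (a n)) -
    ((n : ℕ) : K)⁻¹ • (MvPolynomial.pderiv (b n)).toLinearMap

lemma pderiv_comm (i j : ℕ+ ⊕ ℕ+) (p : Pol₂) :
    MvPolynomial.pderiv i (MvPolynomial.pderiv j p) =
      MvPolynomial.pderiv j (MvPolynomial.pderiv i p) := by
  have h : ⁅MvPolynomial.pderiv (R := K) i, MvPolynomial.pderiv (R := K) j⁆ = 0 := by
    classical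
    ext k
    simp [Derivation.commutator_apply, MvPolynomial.pderiv_X, Pi.single_apply, apply_ite]
  have := congrArg (fun D => D p) h
  simpa [Derivation.commutator_apply, sub_eq_zero] using this

lemma shiftOp_comm {a b : ℕ+ → ℕ+ ⊕ ℕ+} (hab : ∀ n m, a n ≠ b m) :
    ∀ u ∈ Set.range (shiftOp a b), ∀ v ∈ Set.range (shiftOp a b), u * v = v * u := by
  rintro _ ⟨n, rfl⟩ _ ⟨m, rfl⟩
  refine LinearMap.ext fun p => ?_
  simp only [shiftOp, Module.End.mul_apply, LinearMap.sub_apply, LinearMap.smul_apply,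
    LinearMap.mulLeft_apply, Derivation.coeFn_coe,
    MvPolynomial.pderiv_mul, MvPolynomial.pderiv_X_of_ne (hab _ _),
    pderiv_comm (b n) (b m) p, smul_sub, mul_sub, mul_smul_comm, zero_mul, zero_add,
    smul_comm ((n : ℕ) : K)⁻¹ ((m : ℕ) : K)⁻¹, mul_left_comm (MvPolynomial.X (a n))]
  abel

open scoped IsMulCommutative in
/-- Substitution of the commuting operators `X_{a(n)} - (1/n) ∂/∂X_{b(n)}` for the variables of a
polynomial. It is evaluation in the commutative algebra of operators that they generate. -/
def substOp (a b : ℕ+ → ℕ+ ⊕ ℕ+) (hab : ∀ n m, a n ≠ b m) : Pol →ₐ[K] Module.End K Pol₂ :=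
  have : IsMulCommutative (Algebra.adjoin K (Set.range (shiftOp a b))) :=
    Algebra.isMulCommutative_adjoin K (shiftOp_comm hab)
  (Algebra.adjoin K (Set.range (shiftOp a b))).val.comp
    (MvPolynomial.aeval fun n =>
      (⟨shiftOp a b n, Algebra.subset_adjoin ⟨n, rfl⟩⟩ :
        Algebra.adjoin K (Set.range (shiftOp a b))))

lemma substOp_X (a b : ℕ+ → ℕ+ ⊕ ℕ+) (hab : ∀ n m, a n ≠ b m) (n : ℕ+) :
    substOp a b hab (MvPolynomial.X n) = shiftOp a b n := by
  simp [substOp]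

/-- `p(x) ↦ p(x - ∂̃_y)`, where `∂̃_y = (∂/∂y₁, (1/2) ∂/∂y₂, (1/3) ∂/∂y₃, …)`. -/
def substX : Pol →ₐ[K] Module.End K Pol₂ := substOp Sum.inl Sum.inr (by simp)

/-- `p(x) ↦ p(y - ∂̃_x)`, where `∂̃_x = (∂/∂x₁, (1/2) ∂/∂x₂, (1/3) ∂/∂x₃, …)`. -/
def substY : Pol →ₐ[K] Module.End K Pol₂ := substOp Sum.inr Sum.inl (by simp)

/-- Quadruples of integer sequences, in the order `(κ, ν, θ, η)`. -/
abbrev Quad (k n m h : ℕ) : Type :=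
  (Fin k → ℤ) × (Fin n → ℤ) × (Fin m → ℤ) × (Fin h → ℤ)

/-- `(Q_κ(x - ∂̃_y) Q_ν(x - ∂̃_y) Q_θ(y - ∂̃_x) Q_η(y - ∂̃_x)) · 1`, for integer sequences. -/
def mixed {k n m h : ℕ} (a : Quad k n m h) : Pol₂ :=
  (substX (hlSeq a.1) * substX (hlSeq a.2.1) * substY (hlSeq a.2.2.1) * substY (hlSeq a.2.2.2)) 1

/-- The shifts of the operators `D_{κ_i η_j}` (left summand) and `D_{θ_m ν_n}` (right summand):
each lowers the two positions that it names by one. -/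
def crossShift {k n m h : ℕ} : (Fin k × Fin h) ⊕ (Fin m × Fin n) → Quad k n m h :=
  Sum.elim (fun d => (-unitVec d.1, 0, 0, -unitVec d.2))
    (fun d => (0, -unitVec d.2, -unitVec d.1, 0))

/-- The product of `(1 - t D)² / ((1 - D) (1 - t² D))` over all `D = D_{κ_i η_j}` and all
`D = D_{θ_m ν_n}`, applied to a formal symbol `F` with index `a = (κ, ν, θ, η)`. -/
def crossOps {k n m h : ℕ} (F : Quad k n m h → Pol₂) (a : Quad k n m h) : Pol₂ :=
  applyOps (fun _ => decouplingSeries) crossShift F a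

/-- The index vector `(κ, ν, θ, η)` of four Young diagrams. -/
def quadParts (kap nu the eta : YoungDiagram) :
    Quad (kap.colLen 0) (nu.colLen 0) (the.colLen 0) (eta.colLen 0) :=
  (parts kap, parts nu, parts the, parts eta)

end CoupledHL

end

/-!
The translation `y_n ↦ y_n - (1 - tⁿ) zⁿ / n` multiplies `exp ξ_t(y, w)` by
`exp (-∑ (1 - tⁿ)² zⁿ wⁿ / n)`, which is the series `(1 - u) (1 - t² u) / (1 - t u)²` at `u = z w`.
So moving all derivatives in `q_α(x - ∂̃_y) q_β(y)` to the right amounts to applying the coupling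
operators of all pairs in `α × β` to `q_{[α,β]}`. In particular `Q_α(x - ∂̃_y) Q_β(y) = Q_{[α,β]}`,
and `Φ(κ, ν, θ, η)` carries a coupling operator for every pair in `κν × θη`. The product
`Q_{[κ,θ]} Q_{[ν,η]}` lacks exactly those of the pairs in `κ × η` and `ν × θ`, and dividing `Φ` by
them is the product formula.

The `Q_λ` form a basis because they are unitriangular over the basis of products `q_λ`: raising
operators preserve the sum of the parts and increase the sum of their squares.
-/

noncomputable section

namespace CoupledHL

open PowerSeries (coeff)
open MvPolynomial (rename pderiv)
open Finset.HasAntidiagonal (antidiagonal mem_antidiagonal)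

section Operators

variable {ι ι' A B V W U : Type} [AddCommGroup A] [AddCommGroup B] [AddCommGroup V] [AddCommGroup W]
  [AddCommGroup U]

/-- The weight `w` strictly decreases along every shift in `s`. Together with `BoundedBy` it makes
the sum in `applyOps` finite. -/
def Lowers (w : A →+ ℤ) (s : ι → A) : Prop := ∀ e, w (s e) < 0

/-- The formal symbol `F` vanishes at indices of negative weight. -/
def BoundedBy (w : A →+ ℤ) (F : A → V) : Prop := ∀ a, F a ≠ 0 → 0 ≤ w a

lemma Lowers.sumElim {w : A →+ ℤ} {s : ι → A} {s' : ι' → A} (hs : Lowers w s)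
    (hs' : Lowers w s') : Lowers w (Sum.elim s s') :=
  Sum.rec hs hs'

lemma Lowers.coprod {w : A →+ ℤ} {w' : B →+ ℤ} {s : ι → A} {s' : ι' → B} (hs : Lowers w s)
    (hs' : Lowers w' s') :
    Lowers (w.coprod w') (Sum.elim (fun e => (s e, 0)) fun e => (0, s' e)) :=
  Lowers.sumElim (fun e => by simpa using hs e) fun e => by simpa using hs' e

variable [Fintype ι] [Fintype ι']

lemma Lowers.weight_add_sum_le {w : A →+ ℤ} {s : ι → A} (hs : Lowers w s) (a : A) (k : ι → ℕ) :
    w (a + ∑ e, k e • s e) ≤ w a - ∑ e, (k e : ℤ) := by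
  rw [map_add, map_sum, sub_eq_add_neg, ← Finset.sum_neg_distrib]
  gcongr with e
  rw [map_nsmul, nsmul_eq_mul]
  nlinarith [hs e]

lemma BoundedBy.finite {w : A →+ ℤ} {s : ι → A} {F : A → V} (hF : BoundedBy w F)
    (hs : Lowers w s) (a : A) : {k : ι → ℕ | F (a + ∑ e, k e • s e) ≠ 0}.Finite := by
  classical
  refine (Set.finite_Icc 0 fun _ : ι => (w a).toNat).subset fun k hk => ⟨zero_le, fun e => ?_⟩
  change k e ≤ (w a).toNat
  have hsum := (hF _ hk).trans (hs.weight_add_sum_le a k)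
  have hle : (k e : ℤ) ≤ ∑ e, (k e : ℤ) :=
    Finset.single_le_sum (f := fun e => (k e : ℤ)) (fun _ _ => by positivity) (Finset.mem_univ e)
  omega

variable [Module K V] [Module K W] [Module K U]

lemma BoundedBy.coprod {w : A →+ ℤ} {w' : B →+ ℤ} {F : A → V} {G : B → W} (hF : BoundedBy w F)
    (hG : BoundedBy w' G) (μ : V →ₗ[K] W →ₗ[K] U) :
    BoundedBy (w.coprod w') fun p : A × B => μ (F p.1) (G p.2) := fun p hp => by
  have hp₁ : F p.1 ≠ 0 := fun h => hp (by simp [h])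
  have hp₂ : G p.2 ≠ 0 := fun h => hp (by simp [h])
  simpa using add_nonneg (hF _ hp₁) (hG _ hp₂)

lemma BoundedBy.applyOps {w : A →+ ℤ} {s : ι → A} {F : A → V} (hF : BoundedBy w F)
    (hs : Lowers w s) (φ : ι → K⟦X⟧) : BoundedBy w (applyOps φ s F) := fun a ha => by
  obtain ⟨k, hk⟩ := not_forall.mp (mt finsum_eq_zero_of_forall_eq_zero ha)
  have hsum := (hF _ (right_ne_zero_of_smul hk)).trans (hs.weight_add_sum_le a k)
  have : 0 ≤ ∑ e, (k e : ℤ) := by positivity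
  omega

lemma applyOps_congr {φ : ι → K⟦X⟧} {s : ι → A} {s' : ι → B} {F : A → V} {G : B → V} {a : A}
    {b : B} (h : ∀ k : ι → ℕ, F (a + ∑ e, k e • s e) = G (b + ∑ e, k e • s' e)) :
    applyOps φ s F a = applyOps φ s' G b :=
  finsum_congr fun k => by rw [h]

lemma applyOps_reindex (e : ι ≃ ι') (g : A →+ B) {φ : ι → K⟦X⟧} {ψ : ι' → K⟦X⟧} {s : ι → A}
    {s' : ι' → B} (hφ : ∀ i, ψ (e i) = φ i) (hs : ∀ i, s' (e i) = g (s i)) (F : B → V) (a : A) :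
    applyOps φ s (fun x => F (g x)) a = applyOps ψ s' F (g a) := by
  refine finsum_eq_of_bijective _ (e.arrowCongr (Equiv.refl ℕ)).bijective fun k => ?_
  simp only [← Equiv.prod_comp e, ← Equiv.sum_comp e, hφ, hs, Equiv.arrowCongr_apply,
    Function.comp_apply, Equiv.symm_apply_apply, Equiv.refl_apply, map_add, map_sum, map_nsmul]

lemma applyOps_one (s : ι → A) (F : A → V) (a : A) : applyOps (fun _ => 1) s F a = F a := by
  refine (finsum_eq_single _ 0 fun k hk => ?_).trans (by simp)
  obtain ⟨e, he : k e ≠ 0⟩ := Function.ne_iff.mp hk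
  rw [Finset.prod_eq_zero (Finset.mem_univ e) (by rw [PowerSeries.coeff_one, if_neg he]),
    zero_smul]

lemma map_applyOps (f : V →ₗ[K] W) {φ : ι → K⟦X⟧} {s : ι → A} {F : A → V} {a : A}
    (hF : {k : ι → ℕ | F (a + ∑ e, k e • s e) ≠ 0}.Finite) :
    f (applyOps φ s F a) = applyOps φ s (fun x => f (F x)) a := by
  refine (f.toAddMonoidHom.map_finsum (hF.subset fun k => right_ne_zero_of_smul)).trans ?_
  exact finsum_congr fun k => map_smul f _ _

lemma applyOps_sub_mem {φ : ι → K⟦X⟧} {s : ι → A} {F : A → V} {a : A} (S : Submodule K V)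
    (hφ : ∀ e, coeff 0 (φ e) = 1) (hF : {k : ι → ℕ | F (a + ∑ e, k e • s e) ≠ 0}.Finite)
    (hS : ∀ k : ι → ℕ, k ≠ 0 → F (a + ∑ e, k e • s e) ∈ S) : applyOps φ s F a - F a ∈ S := by
  refine (Submodule.Quotient.eq S).mp ((map_applyOps S.mkQ hF).trans ?_)
  refine (finsum_eq_single _ 0 fun k hk => ?_).trans (by simp [hφ])
  exact (congrArg _ ((Submodule.Quotient.mk_eq_zero S).mpr (hS k hk))).trans (smul_zero _)

lemma applyOps_applyOps {φ : ι → K⟦X⟧} {ψ : ι' → K⟦X⟧} {s : ι → A} {s' : ι' → A} {F : A → V}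
    {a : A} (hF : {k : ι ⊕ ι' → ℕ | F (a + ∑ e, k e • Sum.elim s s' e) ≠ 0}.Finite) :
    applyOps φ s (applyOps ψ s' F) a = applyOps (Sum.elim φ ψ) (Sum.elim s s') F a := by
  let term : (ι ⊕ ι' → ℕ) → V := fun k =>
    (∏ e, coeff (k e) (Sum.elim φ ψ e)) • F (a + ∑ e, k e • Sum.elim s s' e)
  have hterm : (Function.support term).Finite := hF.subset fun k => right_ne_zero_of_smul
  let split := Equiv.sumArrowEquivProdArrow ι ι' ℕ
  calc applyOps φ s (applyOps ψ s' F) a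
      = ∑ᶠ (k) (l), term (split.symm (k, l)) := by
        refine finsum_congr fun k => (smul_finsum _ _).trans (finsum_congr fun l => ?_)
        simp [term, split, smul_smul, add_assoc]
    _ = ∑ᶠ p, term (split.symm p) :=
        (finsum_curry _ (hterm.preimage split.symm.injective.injOn)).symm
    _ = applyOps (Sum.elim φ ψ) (Sum.elim s s') F a := finsum_comp_equiv split.symm

lemma map₂_applyOps {w : A →+ ℤ} {w' : B →+ ℤ} {s : ι → A} {s' : ι' → B} {F : A → V} {G : B → W}
    (hF : BoundedBy w F) (hs : Lowers w s) (hG : BoundedBy w' G) (hs' : Lowers w' s')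
    (μ : V →ₗ[K] W →ₗ[K] U) (φ : ι → K⟦X⟧) (ψ : ι' → K⟦X⟧) (a : A) (b : B) :
    μ (applyOps φ s F a) (applyOps ψ s' G b) =
      applyOps (Sum.elim φ ψ) (Sum.elim (fun e => (s e, 0)) fun e => (0, s' e))
        (fun p => μ (F p.1) (G p.2)) (a, b) := by
  rw [← applyOps_applyOps ((hF.coprod hG μ).finite (hs.coprod hs') _),
    ← LinearMap.flip_apply, map_applyOps _ (hF.finite hs a)]
  refine applyOps_congr fun k => ?_
  rw [LinearMap.flip_apply, map_applyOps _ (hG.finite hs' b)]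
  refine applyOps_congr fun l => ?_
  simp [Prod.fst_sum, Prod.snd_sum]

lemma applyOps_mul {w : A →+ ℤ} {s : ι → A} {F : A → V} (hF : BoundedBy w F) (hs : Lowers w s)
    (φ ψ : ι → K⟦X⟧) (a : A) :
    applyOps φ s (applyOps ψ s F) a = applyOps (fun e => φ e * ψ e) s F a := by
  classical
  let N := (hF.finite hs a).toFinset
  let fiber (n : ι → ℕ) : Finset (ι → ℕ × ℕ) := Fintype.piFinset fun e => antidiagonal (n e)
  have mem_fiber {n : ι → ℕ} {p : ι → ℕ × ℕ} : p ∈ fiber n ↔ ∀ e, (p e).1 + (p e).2 = n e := by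
    simp [fiber]
  let term : (ι → ℕ × ℕ) → V := fun p =>
    (∏ e, coeff (p e).1 (φ e) * coeff (p e).2 (ψ e)) • F (a + ∑ e, ((p e).1 + (p e).2) • s e)
  let split : (ι → ℕ × ℕ) ≃ (ι ⊕ ι → ℕ) :=
    (Equiv.arrowProdEquivProdArrow ι (fun _ => ℕ) fun _ => ℕ).trans
      (Equiv.sumArrowEquivProdArrow ι ι ℕ).symm
  calc applyOps φ s (applyOps ψ s F) a
      = ∑ᶠ p, term p := by
        rw [applyOps_applyOps (hF.finite (hs.sumElim hs) a)]
        refine (finsum_comp_equiv split).symm.trans (finsum_congr fun p => ?_)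
        simp [term, split, Finset.prod_mul_distrib, add_smul, Finset.sum_add_distrib]
    _ = ∑ p ∈ N.biUnion fiber, term p := by
        refine finsum_eq_sum_of_support_subset _ fun p hp => ?_
        simpa [N, mem_fiber, ← funext_iff] using right_ne_zero_of_smul hp
    _ = ∑ n ∈ N, ∑ p ∈ fiber n, term p := by
        refine Finset.sum_biUnion fun n _ n' _ hn => Finset.disjoint_left.mpr fun p hp hp' => ?_
        exact hn (funext fun e => (mem_fiber.mp hp e).symm.trans (mem_fiber.mp hp' e))
    _ = ∑ n ∈ N, (∏ e, coeff (n e) (φ e * ψ e)) • F (a + ∑ e, n e • s e) := by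
        refine Finset.sum_congr rfl fun n _ => ?_
        simp only [PowerSeries.coeff_mul, Finset.prod_univ_sum, Finset.sum_smul]
        exact Finset.sum_congr rfl fun p hp => by simp only [term, mem_fiber.mp hp]
    _ = applyOps (fun e => φ e * ψ e) s F a := by
        refine (finsum_eq_sum_of_support_subset _ fun n hn => ?_).symm
        simpa [N] using right_ne_zero_of_smul hn

end Operators

section Series

variable {R S : Type} [CommRing R] [CommRing S]

lemma derivative_map (f : R →+* S) (P : R⟦X⟧) :
    PowerSeries.derivative S (P.map f) = (PowerSeries.derivative R P).map f := by
  ext n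
  simp [PowerSeries.coeff_derivative]

lemma derivative_rescale (r : R) (P : R⟦X⟧) :
    PowerSeries.derivative R (PowerSeries.rescale r P) =
      PowerSeries.C r * PowerSeries.rescale r (PowerSeries.derivative R P) := by
  ext n
  simp only [PowerSeries.coeff_derivative, PowerSeries.coeff_rescale, PowerSeries.coeff_C_mul]
  ring

lemma derivative_mul_rescale {P L Q M : R⟦X⟧} (hP : PowerSeries.derivative R P = P * L)
    (hQ : PowerSeries.derivative R Q = Q * M) (r : R) :
    PowerSeries.derivative R (P * PowerSeries.rescale r Q) =
      P * PowerSeries.rescale r Q * (L + PowerSeries.C r * PowerSeries.rescale r M) := by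
  rw [Derivation.leibniz, derivative_rescale, hP, hQ, map_mul, smul_eq_mul, smul_eq_mul]
  ring

lemma eq_zero_of_derivative_eq_mul [IsAddTorsionFree R] {P L : R⟦X⟧}
    (hP : PowerSeries.derivative R P = P * L) (h₀ : coeff 0 P = 0) : P = 0 := by
  ext n
  induction n using Nat.strong_induction_on with
  | h n ih =>
    rcases n with _ | n
    · simpa using h₀
    · have hn : (n + 1) • coeff (n + 1) P = 0 := by
        have h := congrArg (coeff n) hP
        rw [PowerSeries.coeff_derivative, PowerSeries.coeff_mul, Finset.sum_eq_zero] at h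
        · rw [nsmul_eq_mul, mul_comm, ← h, Nat.cast_succ]
        · intro p hp
          rw [ih p.1 (Nat.lt_succ_of_le (Finset.HasAntidiagonal.antidiagonal.fst_le hp)),
            map_zero, zero_mul]
      exact (smul_eq_zero_iff_right n.succ_ne_zero).mp hn

/-- The derivation of power series that applies a derivation to every coefficient. -/
def coeffDeriv [Algebra K R] (d : Derivation K R R) (P : R⟦X⟧) : R⟦X⟧ :=
  PowerSeries.mk fun n => d (coeff n P)

lemma coeffDeriv_mul [Algebra K R] (d : Derivation K R R) (P Q : R⟦X⟧) :
    coeffDeriv d (P * Q) = coeffDeriv d P * Q + P * coeffDeriv d Q := by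
  ext n
  simp only [coeffDeriv, PowerSeries.coeff_mk, map_add, PowerSeries.coeff_mul, map_sum,
    Derivation.leibniz, smul_eq_mul, Finset.sum_add_distrib]
  rw [add_comm]
  congr 1
  exact Finset.sum_congr rfl fun _ _ => mul_comm _ _

lemma derivative_coeffDeriv [Algebra K R] (d : Derivation K R R) (P : R⟦X⟧) :
    PowerSeries.derivative R (coeffDeriv d P) = coeffDeriv d (PowerSeries.derivative R P) := by
  ext n
  simp only [coeffDeriv, PowerSeries.coeff_derivative, PowerSeries.coeff_mk, Derivation.leibniz,
    map_add, Derivation.map_natCast, Derivation.map_one_eq_zero, smul_eq_mul, add_zero, mul_zero,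
    zero_add]
  ring

end Series

section OperatorSeries

/-- The geometric series `1 / (1 - r u)`. -/
def geom (r : K) : K⟦X⟧ := PowerSeries.rescale r (PowerSeries.mk 1)

lemma geom_mul_one_sub (r : K) : geom r * (1 - PowerSeries.C r * PowerSeries.X) = 1 := by
  have h := congrArg (PowerSeries.rescale r) (PowerSeries.mk_one_mul_one_sub_eq_one K)
  rwa [map_mul, map_sub, map_one, PowerSeries.rescale_X] at h

lemma inv_one_sub (r : K) : (1 - PowerSeries.C r * PowerSeries.X)⁻¹ = geom r :=
  ((PowerSeries.eq_inv_iff_mul_eq_one (by simp)).mpr (geom_mul_one_sub r)).symm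

lemma derivative_geom (r : K) :
    PowerSeries.derivative K (geom r) = PowerSeries.C r * geom r ^ 2 := by
  rw [← inv_one_sub, PowerSeries.derivative_inv']
  simp only [map_sub, Derivation.leibniz, PowerSeries.derivative_X, PowerSeries.derivative_C,
    Derivation.map_one_eq_zero, smul_eq_mul, mul_zero, mul_one, add_zero, zero_sub]
  ring

lemma coeff_zero_raisingSeries : coeff 0 raisingSeries = 1 := by
  simp [raisingSeries]

lemma couplingSeries_eq_mul_geom_sq : couplingSeries =
    (1 - PowerSeries.X) * (1 - PowerSeries.C (t ^ 2) * PowerSeries.X) * geom t ^ 2 := by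
  rw [couplingSeries]
  congr 1
  refine ((PowerSeries.eq_inv_iff_mul_eq_one (by simp)).mpr ?_).symm
  rw [← mul_pow, geom_mul_one_sub, one_pow]

lemma coeff_zero_couplingSeries : coeff 0 couplingSeries = 1 := by
  simp [couplingSeries]

lemma decouplingSeries_mul_couplingSeries : decouplingSeries * couplingSeries = 1 := by
  rw [decouplingSeries, couplingSeries, mul_assoc, ← mul_assoc _⁻¹,
    PowerSeries.inv_mul_cancel _ (by simp), one_mul, PowerSeries.mul_inv_cancel _ (by simp)]

/-- The negative logarithmic derivative of the coupling series. Its coefficients are the squares of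
the factors `1 - tⁿ` in `ξ_t`: this is why normal ordering produces exactly the coupling series. -/
def couplingLogDeriv : K⟦X⟧ := PowerSeries.mk fun n => (1 - t ^ (n + 1)) ^ 2

lemma couplingLogDeriv_eq_geom : couplingLogDeriv =
    geom 1 - PowerSeries.C (2 * t) * geom t + PowerSeries.C (t ^ 2) * geom (t ^ 2) := by
  ext n
  simp only [couplingLogDeriv, geom, map_add, map_sub, PowerSeries.coeff_C_mul,
    PowerSeries.coeff_mk, PowerSeries.coeff_rescale, Pi.one_apply]
  ring

lemma derivative_couplingSeries :
    PowerSeries.derivative K couplingSeries = -couplingSeries * couplingLogDeriv := by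
  have h₁ := geom_mul_one_sub 1
  have h₂ := geom_mul_one_sub (t ^ 2)
  rw [map_one, one_mul] at h₁
  rw [couplingLogDeriv_eq_geom, couplingSeries_eq_mul_geom_sq]
  simp only [Derivation.leibniz, Derivation.leibniz_pow, derivative_geom, map_sub,
    PowerSeries.derivative_X, PowerSeries.derivative_C, Derivation.map_one_eq_zero, smul_eq_mul,
    nsmul_eq_mul, Nat.cast_ofNat, map_mul, map_ofNat, Nat.add_one_sub_one, pow_one]
  simp only [map_pow] at h₂ ⊢
  linear_combination ((1 - PowerSeries.C t ^ 2 * PowerSeries.X) * geom t ^ 2) * h₁ +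
    (PowerSeries.C t ^ 2 * (1 - PowerSeries.X) * geom t ^ 2) * h₂

end OperatorSeries

section GeneratingSeries

/-- The generating series `∑_{n ≥ 0} q_n zⁿ = exp ξ_t`. -/
def qSeries : Pol⟦X⟧ := PowerSeries.subst xi (PowerSeries.exp Pol)

lemma q_natCast (n : ℕ) : q n = coeff n qSeries := rfl

lemma q_of_neg : ∀ {n : ℤ}, n < 0 → q n = 0
  | Int.negSucc _, _ => rfl

lemma nonneg_of_q_ne_zero {n : ℤ} (h : q n ≠ 0) : 0 ≤ n :=
  not_lt.mp fun hn => h (q_of_neg hn)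

lemma constantCoeff_xi : PowerSeries.constantCoeff xi = 0 := by
  rw [← PowerSeries.coeff_zero_eq_constantCoeff_apply, xi, PowerSeries.coeff_mk,
    dif_neg (lt_irrefl 0)]

lemma coeff_xi (n : ℕ+) : coeff (n : ℕ) xi = (1 - t ^ (n : ℕ)) • MvPolynomial.X n := by
  rw [xi, PowerSeries.coeff_mk, dif_pos n.pos, MvPolynomial.smul_eq_C_mul]
  rfl

lemma hasSubst_xi : PowerSeries.HasSubst xi :=
  PowerSeries.HasSubst.of_constantCoeff_zero' constantCoeff_xi

lemma q_zero : q 0 = 1 := by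
  have h := PowerSeries.constantCoeff_subst_eq_zero constantCoeff_xi
    (PowerSeries.exp Pol - 1) (by simp)
  rw [← PowerSeries.coe_substAlgHom hasSubst_xi, map_sub, map_one, map_sub, sub_eq_zero,
    PowerSeries.coe_substAlgHom hasSubst_xi, map_one] at h
  rw [← Nat.cast_zero, q_natCast, PowerSeries.coeff_zero_eq_constantCoeff_apply]
  exact h

lemma derivative_qSeries :
    PowerSeries.derivative Pol qSeries = qSeries * PowerSeries.derivative Pol xi := by
  rw [qSeries, PowerSeries.derivative_subst hasSubst_xi, PowerSeries.derivative_exp]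

lemma map_qSeries_eq {R : Type} [CommRing R] [IsAddTorsionFree R] (f : Pol →+* R) {P : R⟦X⟧}
    (h₀ : coeff 0 P = 1)
    (hP : PowerSeries.derivative R P = P * (PowerSeries.derivative Pol xi).map f) :
    qSeries.map f = P := by
  refine sub_eq_zero.mp (eq_zero_of_derivative_eq_mul
    (L := (PowerSeries.derivative Pol xi).map f) ?_ ?_)
  · rw [map_sub, derivative_map, derivative_qSeries, hP, map_mul, sub_mul]
  · rw [map_sub, PowerSeries.coeff_map, ← q_natCast, Nat.cast_zero, q_zero, map_one, h₀, sub_self]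

lemma coeffDeriv_qSeries (d : Derivation K Pol Pol) :
    coeffDeriv d qSeries = qSeries * coeffDeriv d xi := by
  refine sub_eq_zero.mp (eq_zero_of_derivative_eq_mul
    (L := PowerSeries.derivative Pol xi) ?_ ?_)
  · rw [map_sub, derivative_coeffDeriv, derivative_qSeries, coeffDeriv_mul, Derivation.leibniz,
      derivative_qSeries, derivative_coeffDeriv, smul_eq_mul, smul_eq_mul]
    ring
  · simp only [coeffDeriv, map_sub, PowerSeries.coeff_mul, PowerSeries.coeff_mk, ← q_natCast,
      PowerSeries.coeff_zero_eq_constantCoeff_apply, constantCoeff_xi, Nat.cast_zero, q_zero,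
      Finset.HasAntidiagonal.antidiagonal_zero, Finset.sum_singleton, map_zero,
      Derivation.map_one_eq_zero, mul_zero, sub_self]

lemma coeffDeriv_pderiv_xi (n : ℕ+) :
    coeffDeriv (pderiv n) xi =
      PowerSeries.C (MvPolynomial.C (1 - t ^ (n : ℕ))) * PowerSeries.X ^ (n : ℕ) := by
  ext1 m
  rw [coeffDeriv, PowerSeries.coeff_mk, PowerSeries.coeff_C_mul_X_pow]
  rcases m.eq_zero_or_pos with rfl | hm
  · rw [PowerSeries.coeff_zero_eq_constantCoeff_apply, constantCoeff_xi, map_zero,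
      if_neg n.ne_zero.symm]
  · lift m to ℕ+ using hm
    rw [coeff_xi, Derivation.map_smul]
    split_ifs with h
    · rw [PNat.coe_inj.mp h, MvPolynomial.pderiv_X_self, MvPolynomial.smul_eq_C_mul, mul_one]
    · rw [MvPolynomial.pderiv_X_of_ne fun h' => h (congrArg _ h'), smul_zero]

lemma pderiv_q (n : ℕ+) (m : ℤ) : pderiv n (q m) = (1 - t ^ (n : ℕ)) • q (m - n) := by
  rcases lt_or_ge m 0 with hm | hm
  · rw [q_of_neg hm, q_of_neg (by have := n.pos; omega), map_zero, smul_zero]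
  · lift m to ℕ using hm
    have h := congrArg (coeff m) (coeffDeriv_qSeries (pderiv n))
    rw [coeffDeriv_pderiv_xi, mul_left_comm, PowerSeries.coeff_C_mul, PowerSeries.coeff_mul_X_pow',
      coeffDeriv, PowerSeries.coeff_mk] at h
    rw [q_natCast, MvPolynomial.smul_eq_C_mul, h]
    split_ifs with hn
    · rw [← q_natCast, Nat.cast_sub hn]
    · rw [q_of_neg (by omega)]

end GeneratingSeries

section Commutation

variable {a b : ℕ+ → ℕ+ ⊕ ℕ+} {hab : ∀ n m, a n ≠ b m}

lemma substOp_mul_X (p : Pol) (n : ℕ+) (g : Pol₂) :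
    substOp a b hab (p * MvPolynomial.X n) g = substOp a b hab p (shiftOp a b n g) := by
  rw [map_mul, Module.End.mul_apply, substOp_X]

lemma shiftOp_apply (n : ℕ+) (g : Pol₂) :
    shiftOp a b n g = MvPolynomial.X (a n) * g - ((n : ℕ) : K)⁻¹ • pderiv (b n) g :=
  rfl

lemma shiftOp_mul_X (hb : Function.Injective b) (m n : ℕ+) (g : Pol₂) :
    shiftOp a b m (g * MvPolynomial.X (b n)) =
      shiftOp a b m g * MvPolynomial.X (b n) - if m = n then ((n : ℕ) : K)⁻¹ • g else 0 := by
  simp only [shiftOp_apply, MvPolynomial.pderiv_mul, sub_mul, smul_mul_assoc, smul_add]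
  split_ifs with hmn
  · rw [hmn, MvPolynomial.pderiv_X_self, mul_one]
    ring
  · rw [MvPolynomial.pderiv_X_of_ne fun h => hmn (hb h).symm, mul_zero, smul_zero]
    ring

lemma substOp_mul_X_right (hb : Function.Injective b) (p : Pol) (n : ℕ+) (g : Pol₂) :
    substOp a b hab p (g * MvPolynomial.X (b n)) =
      substOp a b hab p g * MvPolynomial.X (b n) -
        ((n : ℕ) : K)⁻¹ • substOp a b hab (pderiv n p) g := by
  induction p using MvPolynomial.induction_on generalizing g with
  | C c =>
    rw [← MvPolynomial.algebraMap_eq, AlgHom.commutes, Derivation.map_algebraMap, map_zero]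
    simp [Module.algebraMap_end_apply]
  | add p₁ p₂ h₁ h₂ =>
    simp only [map_add, LinearMap.add_apply, h₁, h₂, smul_add]
    ring
  | mul_X p m h =>
    rw [substOp_mul_X, shiftOp_mul_X hb, map_sub, h, substOp_mul_X, MvPolynomial.pderiv_mul,
      map_add, LinearMap.add_apply, substOp_mul_X, smul_add, sub_sub]
    split_ifs with hmn
    · rw [hmn, MvPolynomial.pderiv_X_self, mul_one, map_smul]
    · rw [MvPolynomial.pderiv_X_of_ne hmn, mul_zero, map_zero, map_zero, LinearMap.zero_apply,
        smul_zero]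

lemma pderiv_rename_of_forall_ne {σ τ : Type} {f : σ → τ} {j : τ} (h : ∀ n, f n ≠ j)
    (p : MvPolynomial σ K) : pderiv j (rename f p) = 0 := by
  classical
  refine MvPolynomial.pderiv_eq_zero_of_notMem_vars fun hj => ?_
  obtain ⟨n, _, hn⟩ := Finset.mem_image.1 (MvPolynomial.vars_rename f p hj)
  exact h n hn

lemma substOp_rename (p f : Pol) :
    substOp a b hab p (rename a f) = rename a (p * f) := by
  induction p using MvPolynomial.induction_on generalizing f with
  | C c =>
    rw [← MvPolynomial.algebraMap_eq, AlgHom.commutes, Module.algebraMap_end_apply,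
      ← Algebra.smul_def, map_smul]
  | add p₁ p₂ h₁ h₂ => rw [map_add, LinearMap.add_apply, h₁, h₂, add_mul, map_add]
  | mul_X p n h =>
    rw [substOp_mul_X, shiftOp_apply, pderiv_rename_of_forall_ne (fun m => hab m n), smul_zero,
      sub_zero, ← MvPolynomial.rename_X, ← map_mul, h, mul_assoc]

lemma substX_rename (p f : Pol) :
    substX p (rename Sum.inl f) = rename Sum.inl (p * f) :=
  substOp_rename p f

lemma substY_one (p : Pol) : substY p 1 = rename Sum.inr p := by
  have h := substOp_rename (a := Sum.inr) (b := Sum.inl) (hab := by simp) p 1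
  rwa [map_one, mul_one] at h

end Commutation

section VertexOperator

/-- The algebra homomorphism `exp (-∑ (1 - tⁿ) zⁿ / n · ∂/∂x_n)`, which translates `x_n` by
`-(1 - tⁿ) zⁿ / n`. Moving the vertex operator `∑ q_n(x - ∂̃_y) zⁿ` past multiplication by a
polynomial in `y` has this effect on the polynomial. -/
def translate : Pol →ₐ[K] Pol⟦X⟧ :=
  MvPolynomial.aeval fun n => PowerSeries.C (MvPolynomial.X n) -
    ((1 - t ^ (n : ℕ)) / ((n : ℕ) : K)) • PowerSeries.X ^ (n : ℕ)

lemma translate_X (n : ℕ+) : translate (MvPolynomial.X n) = PowerSeries.C (MvPolynomial.X n) -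
    ((1 - t ^ (n : ℕ)) / ((n : ℕ) : K)) • PowerSeries.X ^ (n : ℕ) :=
  MvPolynomial.aeval_X _ _

lemma map_translate_derivative_xi :
    (PowerSeries.derivative Pol xi).map (translate : Pol →+* Pol⟦X⟧) =
      (PowerSeries.derivative Pol xi).map PowerSeries.C +
        PowerSeries.C PowerSeries.X *
          PowerSeries.rescale PowerSeries.X ((-couplingLogDeriv).map (algebraMap K Pol⟦X⟧)) := by
  ext1 m
  have hm : ((m + 1 : ℕ) : K) ≠ 0 := Nat.cast_ne_zero.mpr m.succ_ne_zero
  have hcast : (m : Pol⟦X⟧) + 1 = algebraMap K Pol⟦X⟧ (m + 1 : ℕ) := by simp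
  have hxi := coeff_xi m.succPNat
  rw [Nat.succPNat_coe, Nat.succ_eq_add_one] at hxi
  simp only [PowerSeries.coeff_map, PowerSeries.coeff_derivative, hxi,
    PowerSeries.coeff_C_mul, PowerSeries.coeff_rescale, couplingLogDeriv, PowerSeries.coeff_mk,
    RingHom.coe_coe, map_mul, map_add, map_natCast, map_one, map_smul, translate_X,
    Nat.succPNat_coe, Nat.succ_eq_add_one, map_neg]
  have hsq : algebraMap K Pol⟦X⟧ ((1 - t ^ (m + 1)) * ((1 - t ^ (m + 1)) / (m + 1 : ℕ))) *
      algebraMap K Pol⟦X⟧ (m + 1 : ℕ) = algebraMap K Pol⟦X⟧ ((1 - t ^ (m + 1)) ^ 2) := by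
    rw [← map_mul, mul_assoc, div_mul_cancel₀ _ hm, sq]
  rw [hcast, MvPolynomial.smul_eq_C_mul, ← MvPolynomial.algebraMap_eq, map_mul, smul_sub, smul_smul,
    sub_mul, Algebra.smul_def, Algebra.smul_def, mul_right_comm _ (PowerSeries.X ^ _), hsq,
    PowerSeries.algebraMap_apply]
  ring

lemma map_translate_qSeries :
    qSeries.map (translate : Pol →+* Pol⟦X⟧) =
      qSeries.map PowerSeries.C *
        PowerSeries.rescale PowerSeries.X (couplingSeries.map (algebraMap K Pol⟦X⟧)) := by
  have := IsAddTorsionFree.of_module_rat Pol⟦X⟧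
  refine map_qSeries_eq _ ?_ ?_
  · rw [PowerSeries.coeff_mul, Finset.HasAntidiagonal.antidiagonal_zero, Finset.sum_singleton,
      PowerSeries.coeff_rescale, PowerSeries.coeff_map, PowerSeries.coeff_map, ← q_natCast,
      coeff_zero_couplingSeries, Nat.cast_zero, q_zero, map_one, map_one, pow_zero, mul_one,
      mul_one]
  · rw [map_translate_derivative_xi]
    refine derivative_mul_rescale ?_ ?_ _
    · rw [derivative_map, derivative_qSeries, map_mul]
    · rw [derivative_map, derivative_couplingSeries, neg_mul, ← mul_neg, map_mul]

lemma coeff_translate_q (l : ℕ) (m : ℤ) :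
    coeff l (translate (q m)) = coeff l couplingSeries • q (m - l) := by
  rcases lt_or_ge m 0 with hm | hm
  · rw [q_of_neg hm, q_of_neg (by omega), map_zero, map_zero, smul_zero]
  lift m to ℕ using hm
  have hterm (i j : ℕ) : coeff l (PowerSeries.C (q i) *
      (PowerSeries.X ^ j * algebraMap K Pol⟦X⟧ (coeff j couplingSeries))) =
        if l = j then coeff j couplingSeries • q i else 0 := by
    rw [PowerSeries.algebraMap_apply, mul_comm (PowerSeries.X ^ j), PowerSeries.coeff_C_mul,
      PowerSeries.coeff_C_mul_X_pow, mul_ite, mul_zero, mul_comm, ← Algebra.smul_def]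
  have h := congrArg (coeff l) (congrArg (coeff m) map_translate_qSeries)
  rw [PowerSeries.coeff_mul, map_sum, ← Finset.Nat.sum_antidiagonal_swap,
    Finset.Nat.sum_antidiagonal_eq_sum_range_succ_mk] at h
  simp only [PowerSeries.coeff_map, PowerSeries.coeff_rescale, ← q_natCast, RingHom.coe_coe,
    Prod.swap_prod_mk, hterm, Finset.sum_ite_eq, Finset.mem_range] at h
  rw [h]
  split_ifs with hl
  · rw [Nat.cast_sub (Nat.lt_succ_iff.mp hl)]
  · rw [q_of_neg (by omega), smul_zero]

/-- The generating series `∑_{n ≥ 0} (q_n(x - ∂̃_y) g) zⁿ`. -/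
def vertexSeries (g : Pol₂) : Pol₂⟦X⟧ := PowerSeries.mk fun n => substX (q n) g

lemma vertexSeries_mul_X (g : Pol₂) (n : ℕ+) :
    vertexSeries (g * MvPolynomial.X (Sum.inr n)) =
      vertexSeries g * PowerSeries.mapAlgHom (rename Sum.inr) (translate (MvPolynomial.X n)) := by
  ext1 m
  rw [translate_X, map_sub (PowerSeries.mapAlgHom _), map_smul (PowerSeries.mapAlgHom _),
    PowerSeries.mapAlgHom_apply, PowerSeries.mapAlgHom_apply, PowerSeries.map_C, map_pow,
    PowerSeries.map_X, mul_sub, mul_smul_comm, map_sub, PowerSeries.coeff_smul,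
    PowerSeries.coeff_mul_C, PowerSeries.coeff_mul_X_pow', RingHom.coe_coe, MvPolynomial.rename_X]
  simp only [vertexSeries, PowerSeries.coeff_mk]
  rw [substX, substOp_mul_X_right Sum.inr_injective, pderiv_q, map_smul, LinearMap.smul_apply,
    smul_smul, ← div_eq_inv_mul]
  split_ifs with hn
  · rw [Nat.cast_sub hn]
  · rw [q_of_neg (n := m - n) (by omega), map_zero, LinearMap.zero_apply]

lemma vertexSeries_mul_rename (g : Pol₂) (f : Pol) :
    vertexSeries (g * rename Sum.inr f) =
      vertexSeries g * PowerSeries.mapAlgHom (rename Sum.inr) (translate f) := by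
  induction f using MvPolynomial.induction_on generalizing g with
  | C c =>
    rw [← MvPolynomial.algebraMap_eq, AlgHom.commutes, AlgHom.commutes, AlgHom.commutes,
      mul_comm, ← Algebra.smul_def, mul_comm, ← Algebra.smul_def]
    ext1 n
    simp only [vertexSeries, map_smul, PowerSeries.coeff_mk, PowerSeries.coeff_smul]
  | add f₁ f₂ h₁ h₂ =>
    simp only [map_add, mul_add, ← h₁, ← h₂]
    ext1 n
    simp only [vertexSeries, map_add, PowerSeries.coeff_mk]
  | mul_X f n h =>
    rw [map_mul, map_mul, map_mul, MvPolynomial.rename_X, ← mul_assoc, vertexSeries_mul_X, h,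
      mul_assoc]

variable {J : Type} [Fintype J] [DecidableEq J]

lemma coeff_prod_translate_q (β : J → ℤ) (m : ℕ) :
    coeff m (∏ j, translate (q (β j))) = ∑ k ∈ Finset.univ.finsuppAntidiag m,
      (∏ j, coeff (k j) couplingSeries) • ∏ j, q (β j - k j) := by
  simp only [PowerSeries.coeff_prod, coeff_translate_q, Finset.prod_smul]

lemma substX_q_natCast_mul_prod (g : Pol₂) (n : ℕ) (β : J → ℤ) :
    substX (q n) (g * ∏ j, rename Sum.inr (q (β j))) =
      ∑ p ∈ antidiagonal n, ∑ k ∈ Finset.univ.finsuppAntidiag p.2,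
        (∏ j, coeff (k j) couplingSeries) •
          (substX (q p.1) g * ∏ j, rename Sum.inr (q (β j - k j))) := by
  have h := congrArg (coeff n) (vertexSeries_mul_rename g (∏ j, q (β j)))
  rw [vertexSeries, PowerSeries.coeff_mk, map_prod] at h
  rw [h, PowerSeries.coeff_mul, map_prod]
  refine Finset.sum_congr rfl fun p _ => ?_
  rw [PowerSeries.mapAlgHom_apply, PowerSeries.coeff_map, coeff_prod_translate_q, map_sum,
    Finset.mul_sum]
  simp only [vertexSeries, PowerSeries.coeff_mk, RingHom.coe_coe, map_smul, map_prod,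
    mul_smul_comm]

lemma finsum_eq_sum_antidiagonal_finsuppAntidiag {M : Type} [AddCommMonoid M] {n : ℕ}
    {f : (J →₀ ℕ) → M} (hf : ∀ k, f k ≠ 0 → ∑ j, k j ≤ n) :
    ∑ᶠ k, f k = ∑ p ∈ antidiagonal n, ∑ k ∈ Finset.univ.finsuppAntidiag p.2, f k := by
  have hsupp : Function.support f ⊆
      ((antidiagonal n).biUnion fun p => Finset.univ.finsuppAntidiag p.2 : Finset (J →₀ ℕ)) :=
    fun k hk => by
      simpa [Finset.mem_finsuppAntidiag, mem_antidiagonal] using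
        ⟨n - ∑ j, k j, Nat.sub_add_cancel (hf k hk)⟩
  rw [finsum_eq_sum_of_support_subset _ hsupp, Finset.sum_biUnion]
  intro p hp p' hp' hne
  refine Finset.disjoint_left.mpr fun k hk hk' => hne ?_
  exact (Finset.HasAntidiagonal.antidiagonal_congr' hp hp').mpr
    ((Finset.mem_finsuppAntidiag.mp hk).1.symm.trans (Finset.mem_finsuppAntidiag.mp hk').1)

lemma substX_q_mul_prod (g : Pol₂) (n : ℤ) (β : J → ℤ) :
    substX (q n) (g * ∏ j, rename Sum.inr (q (β j))) =
      applyOps (fun _ : J => couplingSeries) (fun j => (-1, -Pi.single j 1))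
        (fun c : ℤ × (J → ℤ) => substX (q c.1) g * ∏ j, rename Sum.inr (q (c.2 j))) (n, β) := by
  let term (k : J →₀ ℕ) : Pol₂ := (∏ j, coeff (k j) couplingSeries) •
    (substX (q (n - ∑ j, (k j : ℤ))) g * ∏ j, rename Sum.inr (q (β j - k j)))
  have hops : applyOps (fun _ : J => couplingSeries) (fun j => (-1, -Pi.single j 1))
      (fun c : ℤ × (J → ℤ) => substX (q c.1) g * ∏ j, rename Sum.inr (q (c.2 j))) (n, β) =
        ∑ᶠ k, term k := by
    refine (finsum_comp_equiv Finsupp.equivFunOnFinite).symm.trans (finsum_congr fun k => ?_)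
    simp [term, Prod.fst_sum, Prod.snd_sum, Pi.single_apply, sub_eq_add_neg]
  rw [hops]
  rcases lt_or_ge n 0 with hn | hn
  · rw [q_of_neg hn, map_zero, LinearMap.zero_apply, finsum_eq_zero_of_forall_eq_zero fun k => ?_]
    have hk : n - ∑ j, (k j : ℤ) < 0 := by
      have : 0 ≤ ∑ j, (k j : ℤ) := by positivity
      omega
    simp only [term, q_of_neg hk, map_zero, LinearMap.zero_apply, zero_mul, smul_zero]
  lift n to ℕ using hn
  have hterm (k : J →₀ ℕ) (hk : term k ≠ 0) : ∑ j, k j ≤ n := by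
    have := nonneg_of_q_ne_zero (n := n - ∑ j, (k j : ℤ)) fun h => hk (by simp [term, h])
    zify
    omega
  rw [substX_q_natCast_mul_prod, finsum_eq_sum_antidiagonal_finsuppAntidiag hterm]
  refine Finset.sum_congr rfl fun p hp => Finset.sum_congr rfl fun k hk => ?_
  have hp : p.1 + p.2 = n := mem_antidiagonal.mp hp
  have hk : ∑ j, k j = p.2 := (Finset.mem_finsuppAntidiag.mp hk).1
  have hdeg : (p.1 : ℤ) = n - ∑ j, (k j : ℤ) := by
    zify at hp hk
    omega
  simp only [term, hdeg]

end VertexOperator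

section NormalOrder

variable {I J : Type} [Fintype I] [Fintype J]

/-- The formal symbol `q_{[α,β]}` for sequences indexed by arbitrary finite types. -/
def qProd (a : (I → ℤ) × (J → ℤ)) : Pol₂ :=
  (∏ i, rename Sum.inl (q (a.1 i))) * ∏ j, rename Sum.inr (q (a.2 j))

/-- The functional `α ↦ ∑ c_i α_i`. -/
def dotWeight (c : I → ℕ) : (I → ℤ) →+ ℤ where
  toFun α := ∑ i, c i * α i
  map_zero' := by simp
  map_add' α β := by simp only [Pi.add_apply, mul_add, Finset.sum_add_distrib]

lemma dotWeight_apply (c : I → ℕ) (α : I → ℤ) : dotWeight c α = ∑ i, c i * α i := rfl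

lemma dotWeight_single [DecidableEq I] (c : I → ℕ) (i : I) :
    dotWeight c (Pi.single i 1) = c i := by
  simp [dotWeight_apply, Pi.single_apply]

lemma boundedBy_prod_q (c : I → ℕ) :
    BoundedBy (dotWeight c) fun α : I → ℤ => ∏ i, q (α i) := fun α hα =>
  Finset.sum_nonneg fun i hi => mul_nonneg (by positivity)
    (nonneg_of_q_ne_zero (Finset.prod_ne_zero_iff.mp hα i hi))

lemma boundedBy_qProd (c : I → ℕ) (d : J → ℕ) :
    BoundedBy ((dotWeight c).coprod (dotWeight d)) (qProd : (I → ℤ) × (J → ℤ) → Pol₂) := by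
  have h := (boundedBy_prod_q c).coprod (boundedBy_prod_q d) ((LinearMap.mul K Pol₂).compl₁₂
    (rename (Sum.inl : ℕ+ → ℕ+ ⊕ ℕ+)).toLinearMap (rename Sum.inr).toLinearMap)
  unfold qProd
  simpa [map_prod] using h

/-- The shift of `D_{ij}`: lower position `i` of the first sequence and position `j` of the second
one. -/
def dShift [DecidableEq I] [DecidableEq J] (d : I × J) : (I → ℤ) × (J → ℤ) :=
  (-Pi.single d.1 1, -Pi.single d.2 1)

lemma lowers_dShift [DecidableEq I] [DecidableEq J] {c : I → ℕ} {d : J → ℕ} (hc : ∀ i, 0 < c i)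
    (hd : ∀ j, 0 < d j) :
    Lowers ((dotWeight c).coprod (dotWeight d)) (dShift : I × J → _) := fun e => by
  simp only [dShift, AddMonoidHom.coprod_apply, map_neg, dotWeight_single]
  have := hc e.1
  have := hd e.2
  omega

lemma substX_q_qProd [DecidableEq I] [DecidableEq J] (n : ℤ) (a : (I → ℤ) × (J → ℤ)) :
    substX (q n) (qProd a) = applyOps (fun _ : J => couplingSeries) (fun j => dShift (none, j))
      qProd ((fun o : Option I => o.elim n a.1), a.2) := by
  rw [qProd, ← map_prod, substX_q_mul_prod]
  refine applyOps_congr fun k => ?_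
  simp only [substX_rename]
  simp [qProd, dShift, Prod.fst_sum, Prod.snd_sum, Fintype.prod_option, map_mul, map_prod]

lemma applyOps_dShift_comp_equiv {I' : Type} [Fintype I'] [DecidableEq I] [DecidableEq I']
    [DecidableEq J] (e : I ≃ I') (α : I' → ℤ) (β : J → ℤ) :
    applyOps (fun _ : I × J => couplingSeries) dShift qProd (fun i => α (e i), β) =
      applyOps (fun _ : I' × J => couplingSeries) dShift qProd (α, β) := by
  let relabel : (I' → ℤ) × (J → ℤ) →+ (I → ℤ) × (J → ℤ) :=
    (LinearMap.funLeft ℤ ℤ e).toAddMonoidHom.prodMap (AddMonoidHom.id _)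
  have relabel_apply (a) : relabel a = (fun i => a.1 (e i), a.2) := rfl
  have relabel_dShift (d : I' × J) : relabel (dShift d) = dShift (e.symm d.1, d.2) := by
    refine Prod.ext (funext fun i => ?_) rfl
    simp only [relabel_apply, dShift, Pi.neg_apply, Pi.single_apply, e.eq_symm_apply]
  have qProd_relabel (a) : qProd (relabel a) = qProd a := by
    rw [qProd, qProd, ← e.prod_comp fun i => rename Sum.inl (q (a.1 i))]
    rfl
  calc applyOps (fun _ : I × J => couplingSeries) dShift qProd (relabel (α, β))
      = applyOps (fun _ : I' × J => couplingSeries) dShift (fun a => qProd (relabel a)) (α, β) :=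
        (applyOps_reindex (e.symm.prodCongr (Equiv.refl J)) relabel (fun _ => rfl)
          (fun d => (relabel_dShift d).symm) qProd (α, β)).symm
    _ = applyOps (fun _ : I' × J => couplingSeries) dShift qProd (α, β) :=
        applyOps_congr fun _ => qProd_relabel _

lemma applyOps_substX_q_qProd [DecidableEq I] [DecidableEq J] (n : ℤ) (α : I → ℤ) (β : J → ℤ) :
    applyOps (fun _ => couplingSeries) dShift (fun a => substX (q n) (qProd a)) (α, β) =
      applyOps (fun _ : Option I × J => couplingSeries) dShift qProd
        (fun o : Option I => o.elim n α, β) := by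
  have hlow : Lowers _ (dShift : Option I × J → _) :=
    lowers_dShift (c := 1) (d := 1) (by simp) (by simp)
  have hfin := (boundedBy_qProd 1 1).finite
    (Lowers.sumElim (fun d : I × J => hlow (some d.1, d.2)) fun j => hlow (none, j))
    (fun o : Option I => o.elim n α, β)
  calc applyOps (fun _ => couplingSeries) dShift (fun a => substX (q n) (qProd a)) (α, β)
      = applyOps (fun _ => couplingSeries) (fun d : I × J => dShift (some d.1, d.2))
          (applyOps (fun _ => couplingSeries) (fun j => dShift (none, j)) qProd)
          (fun o : Option I => o.elim n α, β) := by
        refine applyOps_congr fun k => ?_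
        rw [substX_q_qProd]
        congr 1
        refine Prod.ext (funext fun o => ?_) (funext fun j => ?_)
        · cases o <;> simp [dShift, Prod.fst_sum, Pi.single_apply]
        · simp [dShift, Prod.snd_sum]
    _ = applyOps (fun _ : Option I × J => couplingSeries) dShift qProd
          (fun o : Option I => o.elim n α, β) := by
        rw [applyOps_applyOps hfin]
        refine applyOps_reindex ((Equiv.sumComm _ _).trans optionProdEquiv.symm)
          (AddMonoidHom.id _) ?_ ?_ _ _ <;>
        · rintro (_ | _) <;> rfl

lemma substX_prod_q [DecidableEq I] [DecidableEq J] (α : I → ℤ) (β : J → ℤ) :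
    substX (∏ i, q (α i)) (∏ j, rename Sum.inr (q (β j))) =
      applyOps (fun _ => couplingSeries) dShift qProd (α, β) := by
  refine Fintype.induction_empty_option (P := fun I _ => ∀ [DecidableEq I] (α : I → ℤ),
    substX (∏ i, q (α i)) (∏ j, rename Sum.inr (q (β j))) =
      applyOps (fun _ => couplingSeries) dShift qProd (α, β)) ?_ ?_ ?_ I α
  · intro I I' _ e ih _ α
    let _ := Fintype.ofEquiv I' e.symm
    let _ : DecidableEq I := Classical.decEq I
    rw [← Equiv.prod_comp e, ih fun i => α (e i)]
    exact applyOps_dShift_comp_equiv e α β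
  · intro _ α
    rw [Subsingleton.elim (fun _ : PEmpty × J => couplingSeries) fun _ => 1, applyOps_one]
    simp [qProd]
  · intro I _ ih decEq α
    classical
    obtain rfl : decEq = Option.instDecidableEq := Subsingleton.elim _ _
    obtain ⟨n, α, rfl⟩ : ∃ n α', α = fun o : Option I => o.elim n α' :=
      ⟨α none, fun i => α (some i), funext fun o => by cases o <;> rfl⟩
    rw [← applyOps_substX_q_qProd, Fintype.prod_option, map_mul, Module.End.mul_apply]
    refine (congrArg _ (ih α)).trans (map_applyOps _ ?_)
    exact (boundedBy_qProd 1 1).finite (lowers_dShift (by simp) (by simp)) _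

lemma substX_applyOps_prod_q [DecidableEq I] [DecidableEq J] {P S : Type} [Fintype P] [Fintype S]
    {c : I → ℕ} {d : J → ℕ} {r : P → I → ℤ} {s : S → J → ℤ} (hc : ∀ i, 0 < c i)
    (hd : ∀ j, 0 < d j) (hr : Lowers (dotWeight c) r) (hs : Lowers (dotWeight d) s)
    (φ : P → K⟦X⟧) (ψ : S → K⟦X⟧) (α : I → ℤ) (β : J → ℤ) :
    substX (applyOps φ r (fun α => ∏ i, q (α i)) α)
        (rename Sum.inr (applyOps ψ s (fun β => ∏ j, q (β j)) β)) =
      applyOps (Sum.elim (Sum.elim φ ψ) fun _ => couplingSeries)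
        (Sum.elim (Sum.elim (fun p => (r p, 0)) fun p => (0, s p)) dShift) qProd (α, β) := by
  let pairing : Pol →ₗ[K] Pol →ₗ[K] Pol₂ :=
    substX.toLinearMap.compl₂ (rename (Sum.inr : ℕ+ → ℕ+ ⊕ ℕ+)).toLinearMap
  have hpairing (a : (I → ℤ) × (J → ℤ)) : pairing (∏ i, q (a.1 i)) (∏ j, q (a.2 j)) =
      applyOps (fun _ => couplingSeries) dShift qProd a := by
    rw [← substX_prod_q, ← map_prod]
    rfl
  rw [← applyOps_applyOps ((boundedBy_qProd c d).finite ((hr.coprod hs).sumElim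
    (lowers_dShift hc hd)) _), ← funext hpairing]
  exact map₂_applyOps (boundedBy_prod_q c) hr (boundedBy_prod_q d) hs pairing φ ψ α β

end NormalOrder

section Crossing

variable {k n m h : ℕ}

lemma dotWeight_sumElim {I I' : Type} [Fintype I] [Fintype I'] (c : I → ℕ) (c' : I' → ℕ)
    (α : I → ℤ) (α' : I' → ℤ) :
    dotWeight (Sum.elim c c') (Sum.elim α α') = dotWeight c α + dotWeight c' α' := by
  simp [dotWeight_apply, Fintype.sum_sum_type]

/-- The one-based index of a position. Raising operators lower the weight with these coefficients,
since they move a unit to an earlier position. -/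
def position (i : Fin k) : ℕ := i + 1

lemma lowers_raise : Lowers (dotWeight position) (raise : Pairs k → Fin k → ℤ) := fun p => by
  have : (p.1.1 : ℕ) < p.1.2 := p.2
  simp only [raise, unitVec, map_sub, dotWeight_single, position]
  omega

/-- The shifts of the raising operators of two consecutive sequences, which do not mix them. -/
def raiseSum : Pairs k ⊕ Pairs n → Fin k ⊕ Fin n → ℤ :=
  Sum.elim (fun p => Sum.elim (raise p) 0) fun p => Sum.elim 0 (raise p)

lemma lowers_raiseSum :
    Lowers (dotWeight (Sum.elim position position)) (raiseSum : Pairs k ⊕ Pairs n → _) := by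
  refine Lowers.sumElim (fun p => ?_) fun p => ?_
  · simpa [dotWeight_sumElim] using lowers_raise p
  · simpa [dotWeight_sumElim] using lowers_raise p

lemma hlSeq_mul_hlSeq (κ : Fin k → ℤ) (ν : Fin n → ℤ) :
    hlSeq κ * hlSeq ν = applyOps (fun _ => raisingSeries) raiseSum
      (fun α : Fin k ⊕ Fin n → ℤ => ∏ i, q (α i)) (Sum.elim κ ν) := by
  let append : (Fin k → ℤ) × (Fin n → ℤ) →+ (Fin k ⊕ Fin n → ℤ) :=
    (LinearEquiv.sumArrowLequivProdArrow (Fin k) (Fin n) ℤ ℤ).symm.toLinearMap.toAddMonoidHom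
  have append_apply (a) : append a = Sum.elim a.1 a.2 := rfl
  calc hlSeq κ * hlSeq ν
      = applyOps (Sum.elim (fun _ => raisingSeries) fun _ => raisingSeries)
          (Sum.elim (fun p => (raise p, 0)) fun p => (0, raise p))
          (fun a => (∏ i, q (a.1 i)) * ∏ i, q (a.2 i)) (κ, ν) :=
        map₂_applyOps (boundedBy_prod_q position) lowers_raise (boundedBy_prod_q position)
          lowers_raise (LinearMap.mul K Pol) _ _ κ ν
    _ = applyOps (Sum.elim (fun _ => raisingSeries) fun _ => raisingSeries)
          (Sum.elim (fun p => (raise p, 0)) fun p => (0, raise p))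
          (fun a => ∏ i, q (append a i)) (κ, ν) :=
        applyOps_congr fun _ => by rw [append_apply, Fintype.prod_sum_type]; rfl
    _ = applyOps (fun _ => raisingSeries) raiseSum
          (fun α : Fin k ⊕ Fin n → ℤ => ∏ i, q (α i)) (append (κ, ν)) :=
        applyOps_reindex (Equiv.refl _) append (Sum.rec (fun _ => rfl) fun _ => rfl)
          (Sum.rec (fun _ => rfl) fun _ => rfl) (fun α : Fin k ⊕ Fin n → ℤ => ∏ i, q (α i)) (κ, ν)

/-- The series of the operators that define `coupledSeq`. -/
def pairSeries : Pairs k ⊕ Pairs n ⊕ (Fin k × Fin n) → K⟦X⟧ :=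
  Sum.elim (fun _ => raisingSeries) (Sum.elim (fun _ => raisingSeries) fun _ => couplingSeries)

/-- The shifts of the operators that define `coupledSeq`. -/
def pairShift : Pairs k ⊕ Pairs n ⊕ (Fin k × Fin n) → (Fin k → ℤ) × (Fin n → ℤ) :=
  Sum.elim (fun p => (raise p, 0))
    (Sum.elim (fun p => (0, raise p)) (fun d => (-unitVec d.1, -unitVec d.2)))

/-- The weight of a pair of sequences that all operators in `coupledSeq` lower. -/
def pairWeight : (Fin k → ℤ) × (Fin n → ℤ) →+ ℤ :=
  (dotWeight position).coprod (dotWeight position)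

lemma lowers_pairShift : Lowers pairWeight (pairShift (k := k) (n := n)) :=
  Lowers.sumElim (fun p => by simpa [pairWeight] using lowers_raise p)
    (Lowers.sumElim (fun p => by simpa [pairWeight] using lowers_raise p)
      (lowers_dShift (fun _ => Nat.succ_pos _) fun _ => Nat.succ_pos _))

lemma boundedBy_qPair : BoundedBy pairWeight (qPair (l := k) (m := n)) :=
  boundedBy_qProd position position

lemma boundedBy_coupledSeq :
    BoundedBy pairWeight fun a : (Fin k → ℤ) × (Fin n → ℤ) => coupledSeq a.1 a.2 :=
  boundedBy_qPair.applyOps lowers_pairShift _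

lemma substX_hlSeq_rename_hlSeq (α : Fin k → ℤ) (β : Fin n → ℤ) :
    substX (hlSeq α) (rename Sum.inr (hlSeq β)) = coupledSeq α β := by
  refine (substX_applyOps_prod_q (fun _ => Nat.succ_pos _) (fun _ => Nat.succ_pos _)
    lowers_raise lowers_raise _ _ α β).trans ?_
  refine applyOps_reindex (Equiv.sumAssoc _ _ _) (AddMonoidHom.id _) ?_ ?_ qPair (α, β)
  · rintro ((p | p) | d) <;> rfl
  · rintro ((p | p) | d) <;> rfl

lemma mixed_eq_substX (a : Quad k n m h) :
    mixed a = substX (hlSeq a.1 * hlSeq a.2.1)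
      (rename Sum.inr (hlSeq a.2.2.1 * hlSeq a.2.2.2)) := by
  rw [← substY_one, map_mul, map_mul]
  rfl

lemma mixed_eq_applyOps_qProd (a : Quad k n m h) :
    mixed a = applyOps
      (Sum.elim (Sum.elim (fun _ => raisingSeries) fun _ => raisingSeries) fun _ => couplingSeries)
      (Sum.elim (Sum.elim (fun p => (raiseSum p, 0)) fun p => (0, raiseSum p)) dShift) qProd
      (Sum.elim a.1 a.2.1, Sum.elim a.2.2.1 a.2.2.2) := by
  rw [mixed_eq_substX, hlSeq_mul_hlSeq, hlSeq_mul_hlSeq]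
  exact substX_applyOps_prod_q (Sum.rec (fun _ => Nat.succ_pos _) fun _ => Nat.succ_pos _)
    (Sum.rec (fun _ => Nat.succ_pos _) fun _ => Nat.succ_pos _) lowers_raiseSum lowers_raiseSum
    _ _ _ _

/-- The index `(κ, ν, θ, η)` regrouped as `((κ, θ), (ν, η))`. -/
def regroup : Quad k n m h →+
    ((Fin k → ℤ) × (Fin m → ℤ)) × ((Fin n → ℤ) × (Fin h → ℤ)) where
  toFun a := ((a.1, a.2.2.1), (a.2.1, a.2.2.2))
  map_zero' := rfl
  map_add' _ _ := rfl

/-- The index `((κ, θ), (ν, η))` read as a pair of longer sequences `(κν, θη)`. -/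
def concat : ((Fin k → ℤ) × (Fin m → ℤ)) × ((Fin n → ℤ) × (Fin h → ℤ)) →+
    (Fin k ⊕ Fin n → ℤ) × (Fin m ⊕ Fin h → ℤ) where
  toFun a := (Sum.elim a.1.1 a.2.1, Sum.elim a.1.2 a.2.2)
  map_zero' := Prod.ext Sum.elim_zero_zero Sum.elim_zero_zero
  map_add' _ _ := Prod.ext (Sum.elim_add_add ..) (Sum.elim_add_add ..)

lemma qProd_concat (a : ((Fin k → ℤ) × (Fin m → ℤ)) × ((Fin n → ℤ) × (Fin h → ℤ))) :
    qProd (concat a) = qPair a.1 * qPair a.2 := by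
  simp only [qProd, concat, AddMonoidHom.coe_mk, ZeroHom.coe_mk, Fintype.prod_sum_type,
    Sum.elim_inl, Sum.elim_inr, qPair]
  ring

/-- The weight of a quadruple of sequences that all operators in `mixed` lower. -/
def quadWeight : Quad k n m h →+ ℤ := (pairWeight.coprod pairWeight).comp regroup

lemma lowers_crossShift : Lowers quadWeight (crossShift (k := k) (n := n) (m := m) (h := h)) := by
  have hunit {l : ℕ} (i : Fin l) : dotWeight position (unitVec i) = i + 1 := dotWeight_single _ _
  rintro (d | d) <;>
    simp only [quadWeight, pairWeight, regroup, crossShift, AddMonoidHom.comp_apply,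
      AddMonoidHom.coe_mk, ZeroHom.coe_mk, AddMonoidHom.coprod_apply, Sum.elim_inl, Sum.elim_inr,
      map_neg, map_zero, hunit] <;>
    omega

/-- The one-to-one correspondence between the operators that occur in the crossing formula
`mixed_eq_applyOps_coupledSeq`: on the left the `D_{κη}` and `D_{θν}`, then the operators of
`Q_{[κ,θ]}` and those of `Q_{[ν,η]}`; on the right the raising operators on `κ`, `ν`, `θ`, `η`, then
all operators `D` between the joined sequences `κν` and `θη`. -/
def regroupOps {P₁ P₂ P₃ P₄ I I' J J' : Type} :
    ((I × J') ⊕ (J × I')) ⊕ ((P₁ ⊕ P₃ ⊕ I × J) ⊕ (P₂ ⊕ P₄ ⊕ I' × J')) ≃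
      ((P₁ ⊕ P₂) ⊕ (P₃ ⊕ P₄)) ⊕ ((I ⊕ I') × (J ⊕ J')) where
  toFun := Sum.elim
    (Sum.elim (fun d => .inr (.inl d.1, .inr d.2)) fun d => .inr (.inr d.2, .inl d.1))
    (Sum.elim
      (Sum.elim (fun p => .inl (.inl (.inl p)))
        (Sum.elim (fun p => .inl (.inr (.inl p))) fun d => .inr (.inl d.1, .inl d.2)))
      (Sum.elim (fun p => .inl (.inl (.inr p)))
        (Sum.elim (fun p => .inl (.inr (.inr p))) fun d => .inr (.inr d.1, .inr d.2))))
  invFun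
    | .inl (.inl (.inl p)) => .inr (.inl (.inl p))
    | .inl (.inl (.inr p)) => .inr (.inr (.inl p))
    | .inl (.inr (.inl p)) => .inr (.inl (.inr (.inl p)))
    | .inl (.inr (.inr p)) => .inr (.inr (.inr (.inl p)))
    | .inr (.inl i, .inl j) => .inr (.inl (.inr (.inr (i, j))))
    | .inr (.inl i, .inr j) => .inl (.inl (i, j))
    | .inr (.inr i, .inl j) => .inl (.inr (j, i))
    | .inr (.inr i, .inr j) => .inr (.inr (.inr (.inr (i, j))))
  left_inv := by rintro ((d | d) | ((p | p | d) | (p | p | d))) <;> rfl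
  right_inv := by rintro (((p | p) | (p | p)) | ⟨i | i, j | j⟩) <;> rfl

lemma coupledSeq_mul_coupledSeq (a : ((Fin k → ℤ) × (Fin m → ℤ)) × (Fin n → ℤ) × (Fin h → ℤ)) :
    coupledSeq a.1.1 a.1.2 * coupledSeq a.2.1 a.2.2 =
      applyOps (Sum.elim pairSeries pairSeries)
        (Sum.elim (fun e => (pairShift e, 0)) fun e => (0, pairShift e))
        (fun a => qPair a.1 * qPair a.2) a :=
  map₂_applyOps boundedBy_qPair lowers_pairShift boundedBy_qPair lowers_pairShift
    (LinearMap.mul K Pol₂) _ _ _ _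

lemma shift_regroupOps (e : ((Fin k × Fin h) ⊕ (Fin m × Fin n)) ⊕
      ((Pairs k ⊕ Pairs m ⊕ (Fin k × Fin m)) ⊕ (Pairs n ⊕ Pairs h ⊕ (Fin n × Fin h)))) :
    Sum.elim (Sum.elim (fun p => (raiseSum p, 0)) fun p => (0, raiseSum p)) dShift
        (regroupOps e) =
      concat (Sum.elim (fun e => regroup (crossShift e))
        (Sum.elim (fun e => (pairShift e, 0)) fun e => (0, pairShift e)) e) := by
  rcases e with (⟨i, j⟩ | ⟨j, i⟩) | ((p | p | ⟨i, j⟩) | (p | p | ⟨i, j⟩)) <;>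
    refine Prod.ext (funext ?_) (funext ?_) <;>
    rintro (x | x) <;>
    simp [regroupOps, concat, regroup, crossShift, pairShift, dShift, raiseSum, unitVec,
      Pi.single_apply]

lemma applyOps_qPair_mul_qPair (a : Quad k n m h) :
    applyOps (Sum.elim (fun _ => couplingSeries) (Sum.elim pairSeries pairSeries))
        (Sum.elim (fun e => regroup (crossShift e))
          (Sum.elim (fun e => (pairShift e, 0)) fun e => (0, pairShift e)))
        (fun a => qPair a.1 * qPair a.2) (regroup a) = mixed a := by
  rw [mixed_eq_applyOps_qProd, ← funext qProd_concat]
  refine applyOps_reindex regroupOps concat ?_ shift_regroupOps qProd (regroup a)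
  rintro ((d | d) | ((p | p | d) | (p | p | d))) <;> rfl

lemma mixed_eq_applyOps_coupledSeq (a : Quad k n m h) :
    mixed a = applyOps (fun _ => couplingSeries) crossShift
      (fun a => coupledSeq a.1 a.2.2.1 * coupledSeq a.2.1 a.2.2.2) a := by
  have hlow : Lowers (pairWeight.coprod pairWeight)
      (fun e => regroup (crossShift (k := k) (n := n) (m := m) (h := h) e)) := lowers_crossShift
  have hfin := (boundedBy_qPair.coprod boundedBy_qPair (LinearMap.mul K Pol₂)).finite
    (hlow.sumElim (lowers_pairShift.coprod lowers_pairShift)) (regroup a)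
  calc mixed a
      = applyOps (fun _ => couplingSeries) (fun e => regroup (crossShift e))
          (fun a => coupledSeq a.1.1 a.1.2 * coupledSeq a.2.1 a.2.2) (regroup a) := by
        rw [← applyOps_qPair_mul_qPair, funext coupledSeq_mul_coupledSeq]
        exact (applyOps_applyOps hfin).symm
    _ = applyOps (fun _ => couplingSeries) crossShift
          (fun a => coupledSeq a.1 a.2.2.1 * coupledSeq a.2.1 a.2.2.2) a :=
        (applyOps_reindex (Equiv.refl ((Fin k × Fin h) ⊕ (Fin m × Fin n))) regroup (fun _ => rfl)
          (fun _ => rfl) (fun a => coupledSeq a.1.1 a.1.2 * coupledSeq a.2.1 a.2.2) a).symm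

lemma boundedBy_coupledSeq_mul_coupledSeq :
    BoundedBy quadWeight fun a : Quad k n m h =>
      coupledSeq a.1 a.2.2.1 * coupledSeq a.2.1 a.2.2.2 := fun a ha =>
  boundedBy_coupledSeq.coprod boundedBy_coupledSeq (LinearMap.mul K Pol₂) (regroup a) ha

lemma crossOps_mixed (a : Quad k n m h) :
    crossOps mixed a = coupledSeq a.1 a.2.2.1 * coupledSeq a.2.1 a.2.2.2 := by
  rw [crossOps, funext mixed_eq_applyOps_coupledSeq,
    applyOps_mul boundedBy_coupledSeq_mul_coupledSeq lowers_crossShift,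
    decouplingSeries_mul_couplingSeries, applyOps_one]

lemma boundedBy_mixed : BoundedBy quadWeight (mixed (k := k) (n := n) (m := m) (h := h)) := by
  rw [funext mixed_eq_applyOps_coupledSeq]
  exact boundedBy_coupledSeq_mul_coupledSeq.applyOps lowers_crossShift _

end Crossing

section QBasis

lemma t_pow_ne_one {n : ℕ} (hn : n ≠ 0) : t ^ n ≠ 1 := by
  intro h
  have hX : (Polynomial.X : Polynomial ℚ) ^ n = 1 :=
    RatFunc.algebraMap_injective ℚ (by simpa [t] using h)
  exact hn (by simpa using congrArg Polynomial.natDegree hX)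

lemma natCast_mul_one_sub_t_pow_ne_zero (n : ℕ+) : ((n : ℕ) : K) * (1 - t ^ (n : ℕ)) ≠ 0 :=
  mul_ne_zero (Nat.cast_ne_zero.mpr n.ne_zero) (sub_ne_zero.mpr (t_pow_ne_one n.ne_zero).symm)

lemma coeff_natPred_derivative_xi (n : ℕ+) :
    coeff n.natPred (PowerSeries.derivative Pol xi) =
      (((n : ℕ) : K) * (1 - t ^ (n : ℕ))) • MvPolynomial.X n := by
  rw [PowerSeries.coeff_derivative, PNat.natPred_add_one, coeff_xi, mul_smul, ← Nat.cast_succ,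
    Nat.succ_eq_add_one, PNat.natPred_add_one, mul_comm, ← nsmul_eq_mul, Nat.cast_smul_eq_nsmul]

/-- The series `1 + ∑_{n ≥ 1} x_n zⁿ`. The substitution `x_n ↦ q_n` turns it into `qSeries`. -/
def genericSeries : Pol⟦X⟧ :=
  PowerSeries.mk fun n => if h : 0 < n then MvPolynomial.X (⟨n, h⟩ : ℕ+) else 1

lemma coeff_zero_genericSeries : coeff 0 genericSeries = 1 := by
  rw [genericSeries, PowerSeries.coeff_mk, dif_neg (lt_irrefl 0)]

lemma coeff_genericSeries (n : ℕ+) : coeff (n : ℕ) genericSeries = MvPolynomial.X n := by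
  rw [genericSeries, PowerSeries.coeff_mk, dif_pos n.pos]
  rfl

/-- The logarithmic derivative of `genericSeries`. -/
def genericLogDeriv : Pol⟦X⟧ :=
  PowerSeries.derivative Pol genericSeries * PowerSeries.invOfUnit genericSeries 1

lemma derivative_genericSeries :
    PowerSeries.derivative Pol genericSeries = genericSeries * genericLogDeriv := by
  have h : genericSeries * PowerSeries.invOfUnit genericSeries 1 = 1 :=
    PowerSeries.mul_invOfUnit _ _ <| by
      rw [← PowerSeries.coeff_zero_eq_constantCoeff_apply, coeff_zero_genericSeries, Units.val_one]
  rw [genericLogDeriv, mul_left_comm, h, mul_one]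

/-- The substitution `x_n ↦ q_n`. -/
def toQ : Pol →ₐ[K] Pol := MvPolynomial.aeval fun n : ℕ+ => q (n : ℕ)

lemma toQ_X (n : ℕ+) : toQ (MvPolynomial.X n) = q (n : ℕ) := MvPolynomial.aeval_X _ n

/-- The inverse of `toQ`. Newton's identities `qSeries' = qSeries * xi'` recover
`n (1 - tⁿ) x_n` as a coefficient of the logarithmic derivative of `qSeries`. -/
def ofQ : Pol →ₐ[K] Pol := MvPolynomial.aeval fun n : ℕ+ =>
  (((n : ℕ) : K) * (1 - t ^ (n : ℕ)))⁻¹ • coeff n.natPred genericLogDeriv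

lemma map_toQ_genericSeries : genericSeries.map toQ.toRingHom = qSeries := by
  ext1 n
  rw [PowerSeries.coeff_map, ← q_natCast]
  rcases n.eq_zero_or_pos with rfl | hn
  · rw [coeff_zero_genericSeries, map_one, Nat.cast_zero, q_zero]
  · lift n to ℕ+ using hn
    rw [coeff_genericSeries]
    exact toQ_X n

lemma map_ofQ_derivative_xi :
    (PowerSeries.derivative Pol xi).map ofQ.toRingHom = genericLogDeriv := by
  ext1 m
  obtain ⟨n, rfl⟩ : ∃ n : ℕ+, n.natPred = m := ⟨m.succPNat, Nat.natPred_succPNat m⟩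
  rw [PowerSeries.coeff_map, coeff_natPred_derivative_xi]
  change ofQ _ = _
  rw [map_smul, ofQ, MvPolynomial.aeval_X, smul_inv_smul₀ (natCast_mul_one_sub_t_pow_ne_zero n)]

lemma map_ofQ_qSeries : qSeries.map ofQ.toRingHom = genericSeries :=
  map_qSeries_eq _ coeff_zero_genericSeries
    (by rw [map_ofQ_derivative_xi, derivative_genericSeries])

lemma ofQ_comp_toQ : ofQ.comp toQ = AlgHom.id K Pol := by
  refine MvPolynomial.algHom_ext fun n => ?_
  rw [AlgHom.comp_apply, toQ_X, AlgHom.id_apply, ← coeff_genericSeries, ← map_ofQ_qSeries,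
    PowerSeries.coeff_map, q_natCast]
  rfl

lemma toQ_comp_ofQ : toQ.comp ofQ = AlgHom.id K Pol := by
  let f : Pol →+* Pol := (toQ.comp ofQ).toRingHom
  have hq : qSeries.map f = qSeries := by
    change qSeries.map (toQ.toRingHom.comp ofQ.toRingHom) = qSeries
    rw [PowerSeries.map_comp, RingHom.comp_apply, map_ofQ_qSeries, map_toQ_genericSeries]
  have hq₀ : qSeries ≠ 0 := fun h => one_ne_zero (α := Pol) <| by
    rw [← q_zero, ← Nat.cast_zero, q_natCast, h, map_zero]
  have hxi : (PowerSeries.derivative Pol xi).map f = PowerSeries.derivative Pol xi := by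
    refine mul_left_cancel₀ hq₀ ?_
    rw [← derivative_qSeries, ← hq, ← map_mul, ← derivative_qSeries, ← derivative_map, hq]
  refine MvPolynomial.algHom_ext fun n => ?_
  have hn := congrArg (coeff n.natPred) hxi
  rw [PowerSeries.coeff_map, coeff_natPred_derivative_xi] at hn
  exact smul_right_injective Pol (natCast_mul_one_sub_t_pow_ne_zero n)
    ((map_smul (toQ.comp ofQ) _ _).symm.trans hn)

/-- The polynomials `q_1, q_2, …` are free generators of `ℚ(t)[x₁, x₂, …]`. -/
def qEquiv : Pol ≃ₐ[K] Pol := AlgEquiv.ofAlgHom toQ ofQ toQ_comp_ofQ ofQ_comp_toQ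

/-- The exponent vector of `x_n`, and zero for `n = 0`. -/
def varExp : ℕ → ℕ+ →₀ ℕ
  | 0 => 0
  | n + 1 => Finsupp.single n.succPNat 1

lemma qEquiv_varExp (n : ℕ) : qEquiv (MvPolynomial.monomial (varExp n) 1) = q n := by
  cases n with
  | zero => exact (map_one qEquiv).trans q_zero.symm
  | succ n => exact toQ_X n.succPNat

lemma qEquiv_sum_varExp {l : ℕ} (β : Fin l → ℕ) :
    qEquiv (MvPolynomial.monomial (∑ i, varExp (β i)) 1) = ∏ i, q (β i) := by
  rw [MvPolynomial.monomial_sum_one, map_prod]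
  exact Finset.prod_congr rfl fun i _ => qEquiv_varExp _

/-- The multiplicities of the parts of a Young diagram. -/
def expVec (lam : YoungDiagram) : ℕ+ →₀ ℕ := ∑ i : Fin (lam.colLen 0), varExp (lam.rowLen i)

lemma sum_varExp_apply (L : List ℕ) (n : ℕ+) : (L.map varExp).sum n = L.count (n : ℕ) := by
  induction L with
  | nil => simp
  | cons a L ih =>
    rw [List.map_cons, List.sum_cons, Finsupp.add_apply, ih, List.count_cons, add_comm]
    congr 1
    cases a with
    | zero => simp [varExp, n.ne_zero.symm]
    | succ a => simp [varExp, Finsupp.single_apply, ← PNat.coe_inj]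

lemma expVec_apply (lam : YoungDiagram) (n : ℕ+) : expVec lam n = lam.rowLens.count (n : ℕ) := by
  rw [← sum_varExp_apply, expVec, YoungDiagram.rowLens, List.map_map,
    ← Finset.sum_range fun i => varExp (lam.rowLen i)]
  rfl

lemma expVec_injective : Function.Injective expVec := by
  intro lam mu h
  have count_zero (lam : YoungDiagram) : lam.rowLens.count 0 = 0 :=
    List.count_eq_zero.mpr fun h₀ => (lam.pos_of_mem_rowLens 0 h₀).false
  have hperm : lam.rowLens.Perm mu.rowLens := by
    refine List.perm_iff_count.mpr fun n => ?_
    rcases n.eq_zero_or_pos with rfl | hn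
    · rw [count_zero, count_zero]
    · lift n to ℕ+ using hn
      rw [← expVec_apply, ← expVec_apply, h]
  exact YoungDiagram.equivListRowLens.injective
    (Subtype.ext (hperm.eq_of_sortedGE lam.rowLens_sorted mu.rowLens_sorted))

lemma expVec_surjective : Function.Surjective expVec := by
  intro m
  let L : List ℕ := (m.toMultiset.map PNat.val).sort (· ≥ ·)
  have pos_of_mem : ∀ x ∈ L, 0 < x := by
    intro x hx
    obtain ⟨n, -, rfl⟩ := Multiset.mem_map.mp ((Multiset.mem_sort _).mp hx)
    exact n.pos
  refine ⟨YoungDiagram.ofRowLens L (Multiset.pairwise_sort _ _).sortedGE, ?_⟩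
  ext n
  rw [expVec_apply, YoungDiagram.rowLens_ofRowLens_eq_self pos_of_mem, ← Multiset.coe_count,
    Multiset.sort_eq, Multiset.count_map_eq_count' _ _ PNat.coe_injective,
    Finsupp.count_toMultiset]

/-- The basis of `ℚ(t)[x₁, x₂, …]` formed by the products `q_λ` for Young diagrams `λ`. -/
def qBasis : Module.Basis YoungDiagram K Pol :=
  ((MvPolynomial.basisMonomials ℕ+ K).map qEquiv.toLinearEquiv).reindex
    (Equiv.ofBijective expVec ⟨expVec_injective, expVec_surjective⟩).symm

lemma qBasis_eq_prod_q {lam : YoungDiagram} {l : ℕ} {β : Fin l → ℕ}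
    (h : expVec lam = ∑ i, varExp (β i)) : qBasis lam = ∏ i, q (β i) := by
  rw [← qEquiv_sum_varExp, ← h]
  simp only [qBasis, Module.Basis.reindex_apply, Equiv.symm_symm, Module.Basis.map_apply,
    MvPolynomial.coe_basisMonomials, AlgEquiv.toLinearEquiv_apply]
  rfl

end QBasis

section Unitriangular

variable {ι R M N : Type*} [Ring R] [AddCommGroup M] [Module R M] [LinearOrder N]
  {b : Module.Basis ι R M} {v : ι → M} {d : ι → N}

lemma repr_eq_single_of_sub_mem_span {i j : ι}
    (hv : v j - b j ∈ Submodule.span R (b '' {k | d k < d j})) (hij : d j ≤ d i) :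
    b.repr (v j) i = Finsupp.single j 1 i := by
  have h : b.repr (v j - b j) i = 0 :=
    Finsupp.notMem_support_iff.mp fun hi => (b.mem_span_image.mp hv hi).not_ge hij
  rwa [map_sub, Finsupp.sub_apply, b.repr_self, sub_eq_zero] at h

lemma linearIndependent_of_sub_mem_span
    (hv : ∀ i, v i - b i ∈ Submodule.span R (b '' {k | d k < d i})) : LinearIndependent R v := by
  classical
  rw [linearIndependent_iff]
  intro f hf
  by_contra hne
  obtain ⟨i, hi, hmax⟩ := f.support.exists_max_image d (Finsupp.support_nonempty_iff.mpr hne)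
  refine Finsupp.mem_support_iff.mp hi ?_
  calc f i = ∑ j ∈ f.support, f j * Finsupp.single j 1 i := by
        simp [Finsupp.single_apply]
    _ = b.repr (Finsupp.linearCombination R v f) i := by
        simp only [Finsupp.linearCombination_apply, Finsupp.sum, map_sum, map_smul,
          Finsupp.finsetSum_apply, Finsupp.smul_apply, smul_eq_mul]
        exact Finset.sum_congr rfl fun j hj => by
          rw [repr_eq_single_of_sub_mem_span (hv j) (hmax j hj)]
    _ = 0 := by rw [hf, map_zero, Finsupp.zero_apply]

lemma span_range_eq_top_of_sub_mem_span [WellFoundedLT N]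
    (hv : ∀ i, v i - b i ∈ Submodule.span R (b '' {k | d k < d i})) :
    Submodule.span R (Set.range v) = ⊤ := by
  have hb : ∀ i, b i ∈ Submodule.span R (Set.range v) := fun i => by
    induction i using (InvImage.wf d wellFounded_lt).induction with
    | _ i ih =>
      have hle : Submodule.span R (b '' {k | d k < d i}) ≤ Submodule.span R (Set.range v) :=
        Submodule.span_le.mpr (Set.image_subset_iff.mpr ih)
      rw [← sub_sub_cancel (v i) (b i)]
      exact sub_mem (Submodule.subset_span ⟨i, rfl⟩) (hle (hv i))
  rw [eq_top_iff, ← b.span_eq]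
  exact Submodule.span_le.mpr (Set.range_subset_iff.mpr hb)

end Unitriangular

section Triangularity

variable {l : ℕ}

lemma sum_raise (p : Pairs l) : ∑ i, raise p i = 0 := by
  simp [raise, unitVec]

lemma dotProduct_raise (α : Fin l → ℤ) (p : Pairs l) : α ⬝ᵥ raise p = α p.1.1 - α p.1.2 := by
  simp [raise, unitVec, dotProduct_sub]

lemma sum_add_sum_raise (α : Fin l → ℤ) (c : Pairs l → ℕ) :
    ∑ i, (α + ∑ p, c p • raise p) i = ∑ i, α i := by
  simp only [Pi.add_apply, Finset.sum_add_distrib, Finset.sum_apply, Pi.smul_apply, add_eq_left]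
  rw [Finset.sum_comm]
  exact Finset.sum_eq_zero fun p _ => by rw [← Finset.smul_sum, sum_raise, smul_zero]

lemma sum_raise_ne_zero {c : Pairs l → ℕ} (hc : c ≠ 0) : ∑ p, c p • raise p ≠ 0 := by
  intro h
  have hle := lowers_raise.weight_add_sum_le 0 c
  rw [h, add_zero, map_zero, zero_sub, neg_nonneg] at hle
  refine hc (funext fun p => ?_)
  have hp := Finset.single_le_sum (f := fun p => (c p : ℤ)) (fun _ _ => by positivity)
    (Finset.mem_univ p)
  simp only [Pi.zero_apply]
  omega

lemma dotProduct_self_lt_of_raise {α : Fin l → ℤ} (hα : Antitone α) {c : Pairs l → ℕ}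
    (hc : c ≠ 0) : α ⬝ᵥ α < (α + ∑ p, c p • raise p) ⬝ᵥ (α + ∑ p, c p • raise p) := by
  have hcross : 0 ≤ α ⬝ᵥ ∑ p, c p • raise p := by
    rw [dotProduct_sum]
    refine Finset.sum_nonneg fun p _ => ?_
    rw [dotProduct_smul, dotProduct_raise]
    exact nsmul_nonneg (sub_nonneg.mpr (hα p.2.le)) _
  have hself : 0 < (∑ p, c p • raise p) ⬝ᵥ ∑ p, c p • raise p :=
    (Finset.sum_nonneg fun _ _ => mul_self_nonneg _).lt_of_ne'
      (mt dotProduct_self_eq_zero.mp (sum_raise_ne_zero hc))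
  rw [dotProduct_add, add_dotProduct, add_dotProduct, dotProduct_comm (∑ p, c p • raise p) α]
  linarith

/-- The sum of the parts of a partition given by the multiplicities of its parts. -/
def size : (ℕ+ →₀ ℕ) →+ ℤ := Finsupp.weight fun n : ℕ+ => ((n : ℕ) : ℤ)

/-- The sum of the squares of the parts of a partition given by the multiplicities of its parts. -/
def sqNorm : (ℕ+ →₀ ℕ) →+ ℤ := Finsupp.weight fun n : ℕ+ => ((n : ℕ) : ℤ) ^ 2

lemma size_varExp (n : ℕ) : size (varExp n) = n := by
  cases n <;> simp [varExp, size, Finsupp.weight_single]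

lemma sqNorm_varExp (n : ℕ) : sqNorm (varExp n) = (n : ℤ) * n := by
  cases n <;> simp [varExp, sqNorm, Finsupp.weight_single, sq]

lemma size_nonneg (m : ℕ+ →₀ ℕ) : 0 ≤ size m := by
  rw [size, Finsupp.weight_apply]
  exact Finsupp.sum_nonneg fun n _ => by positivity

lemma sqNorm_le_size_sq (m : ℕ+ →₀ ℕ) : sqNorm m ≤ size m ^ 2 := by
  induction m using Finsupp.induction_linear with
  | zero => simp
  | add m m' ih ih' =>
    rw [map_add, map_add]
    nlinarith [mul_nonneg (size_nonneg m) (size_nonneg m')]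
  | single n c =>
    simp only [size, sqNorm, Finsupp.weight_single, nsmul_eq_mul, mul_pow]
    refine mul_le_mul_of_nonneg_right ?_ (by positivity)
    exact_mod_cast Nat.le_self_pow two_ne_zero c

lemma size_sum_varExp (β : Fin l → ℕ) : size (∑ i, varExp (β i)) = ∑ i, (β i : ℤ) := by
  simp only [map_sum, size_varExp]

lemma sqNorm_sum_varExp (β : Fin l → ℕ) :
    sqNorm (∑ i, varExp (β i)) = (fun i => (β i : ℤ)) ⬝ᵥ fun i => (β i : ℤ) := by
  simp only [map_sum, sqNorm_varExp, dotProduct]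

/-- A natural number that decreases when the parts of `λ` are changed such that their sum stays the
same and the sum of their squares increases. -/
def spread (lam : YoungDiagram) : ℕ := (size (expVec lam) ^ 2 - sqNorm (expVec lam)).toNat

lemma antitone_parts (lam : YoungDiagram) : Antitone (parts lam) := fun _ _ hij =>
  Int.ofNat_le.mpr (lam.rowLen_anti _ _ hij)

lemma prod_q_mem_span {lam : YoungDiagram} {β : Fin l → ℤ}
    (hsize : ∑ i, β i = ∑ i, parts lam i) (hsq : parts lam ⬝ᵥ parts lam < β ⬝ᵥ β) :
    ∏ i, q (β i) ∈ Submodule.span K (qBasis '' {mu | spread mu < spread lam}) := by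
  by_cases hβ : ∀ i, 0 ≤ β i
  · lift β to Fin l → ℕ using hβ
    obtain ⟨mu, hmu⟩ := expVec_surjective (∑ i, varExp (β i))
    have hsize' : size (expVec mu) = size (expVec lam) := by
      rw [hmu, size_sum_varExp, hsize, expVec, size_sum_varExp]
      rfl
    have hsq' : sqNorm (expVec lam) < sqNorm (expVec mu) := by
      rw [hmu, expVec, sqNorm_sum_varExp, sqNorm_sum_varExp]
      exact hsq
    have hle := sqNorm_le_size_sq (expVec mu)
    refine Submodule.subset_span ⟨mu, ?_, qBasis_eq_prod_q hmu⟩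
    change spread mu < spread lam
    rw [hsize'] at hle
    rw [spread, spread, hsize']
    omega
  · push Not at hβ
    obtain ⟨i, hi⟩ := hβ
    rw [Finset.prod_eq_zero (Finset.mem_univ i) (q_of_neg hi)]
    exact Submodule.zero_mem _

lemma Q_sub_qBasis_mem_span (lam : YoungDiagram) :
    Q lam - qBasis lam ∈ Submodule.span K (qBasis '' {mu | spread mu < spread lam}) := by
  have hbasis : qBasis lam = ∏ i, q (parts lam i) := qBasis_eq_prod_q rfl
  rw [hbasis, Q, hlSeq]
  refine applyOps_sub_mem _ (fun _ => coeff_zero_raisingSeries)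
    ((boundedBy_prod_q position).finite lowers_raise _) fun c hc => ?_
  exact prod_q_mem_span (sum_add_sum_raise _ _)
    (dotProduct_self_lt_of_raise (antitone_parts lam) hc)

lemma linearIndependent_Q : LinearIndependent K Q :=
  linearIndependent_of_sub_mem_span Q_sub_qBasis_mem_span

lemma span_range_Q : Submodule.span K (Set.range Q) = ⊤ :=
  span_range_eq_top_of_sub_mem_span Q_sub_qBasis_mem_span

lemma linearCombination_structureConst (kap nu : YoungDiagram) :
    Finsupp.linearCombination K Q (structureConst kap nu) = Q kap * Q nu :=
  Classical.epsilon_spec <| Finsupp.mem_span_range_iff_exists_finsupp.mp <|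
    span_range_Q ▸ Submodule.mem_top

lemma linearCombination_eq_iff (kap nu : YoungDiagram) (f : YoungDiagram →₀ K) :
    Finsupp.linearCombination K Q f = Q kap * Q nu ↔ f = structureConst kap nu := by
  rw [← linearCombination_structureConst]
  exact linearIndependent_Q.eq_iff

end Triangularity

section Diagrams

variable (kap the nu eta : YoungDiagram)

lemma coupledQ_mul_coupledQ :
    coupledQ kap the * coupledQ nu eta = crossOps mixed (quadParts kap nu the eta) := by
  rw [crossOps_mixed]
  simp only [quadParts, coupledQ]

lemma substX_Q_rename_Q (lam mu : YoungDiagram) :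
    substX (Q lam) (rename Sum.inr (Q mu)) = coupledQ lam mu :=
  substX_hlSeq_rename_hlSeq _ _

lemma mixed_quadParts :
    mixed (quadParts kap nu the eta) = (structureConst kap nu).sum fun lam c =>
      (structureConst the eta).sum fun mu d => (c * d) • coupledQ lam mu := by
  have hmixed : mixed (quadParts kap nu the eta) =
      substX (Q kap * Q nu) (rename Sum.inr (Q the * Q eta)) := mixed_eq_substX _
  rw [hmixed, ← linearCombination_structureConst, ← linearCombination_structureConst]
  simp only [Finsupp.linearCombination_apply, Finsupp.sum, map_sum, map_smul, LinearMap.sum_apply,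
    LinearMap.smul_apply, Finset.smul_sum, smul_smul, substX_Q_rename_Q]
  exact Finset.sum_comm.trans (by simp only [mul_comm])

end Diagrams

end CoupledHL

end

theorem mainTheorem4 (kap the nu eta : YoungDiagram) :
    -- the coefficients of `Q_κ Q_ν` and of `Q_θ Q_η` exist and are unique
    (∀ f : YoungDiagram →₀ CoupledHL.K,
      Finsupp.linearCombination CoupledHL.K CoupledHL.Q f = CoupledHL.Q kap * CoupledHL.Q nu ↔
        f = CoupledHL.structureConst kap nu) ∧
    (∀ f : YoungDiagram →₀ CoupledHL.K,
      Finsupp.linearCombination CoupledHL.K CoupledHL.Q f = CoupledHL.Q the * CoupledHL.Q eta ↔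
        f = CoupledHL.structureConst the eta) ∧
    -- only finitely many monomials in the operators `D` contribute to the product formula
    {k : (Fin (kap.colLen 0) × Fin (eta.colLen 0)) ⊕ (Fin (the.colLen 0) × Fin (nu.colLen 0)) → ℕ |
      CoupledHL.mixed (CoupledHL.quadParts kap nu the eta +
        ∑ e, k e • CoupledHL.crossShift e) ≠ 0}.Finite ∧
    -- the product formula
    CoupledHL.coupledQ kap the * CoupledHL.coupledQ nu eta =
      CoupledHL.crossOps CoupledHL.mixed (CoupledHL.quadParts kap nu the eta) ∧
    CoupledHL.mixed (CoupledHL.quadParts kap nu the eta) =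
      (CoupledHL.structureConst kap nu).sum fun lam c =>
        (CoupledHL.structureConst the eta).sum fun mu d =>
          (c * d) • CoupledHL.coupledQ lam mu :=
  ⟨CoupledHL.linearCombination_eq_iff kap nu, CoupledHL.linearCombination_eq_iff the eta,
    CoupledHL.boundedBy_mixed.finite CoupledHL.lowers_crossShift _,
    CoupledHL.coupledQ_mul_coupledQ kap the nu eta, CoupledHL.mixed_quadParts kap the nu eta⟩
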